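/- Let $n\ge 1$ and let $Q$ and $B$ be real $n\times n$ matrices such that $Q$ is symmetric and positive definite and all eigenvalues of $B$ have negative real parts. Put $$Q_t=\int_0^t e^{sB}\,Q\,e^{sB^*}\,ds\quad(0<t\le\infty),\qquad R(x)=\tfrac12\langle Q_\infty^{-1}x,x\rangle,\qquad D_t=Q_\infty e^{-tB^*}Q_\infty^{-1},$$ let $d\gamma_\infty(x)=(2\pi)^{-n/2}(\det Q_\infty)^{-1/2}e^{-R(x)}\,dx$, and for $t>0$ and $x,u\in\mathbb R^n$ let $$K_t(x,u)=\Big(\frac{\det Q_\infty}{\det Q_t}\Big)^{1/2}e^{R(x)}\exp\Big[-\tfrac12\big\langle (Q_t^{-1}-Q_\infty^{-1})(u-D_tx),\,u-D_tx\big\rangle\Big].$$ Localization: let $(x_j)_{j\ge 0}$ be a sequence in $\mathbb R^n$ with $x_0=0$ such that the open balls $B_j=B\big(x_j,\tfrac1{1+|x_j|}\big)$ are pairwise disjoint and the family is maximal, i.e. for every $y\in\mathbb R^n$ the ball $B\big(y,\tfrac1{1+|y|}\big)$ meets some $B_j$. Write $kB_j$ for the concentric $k$-fold scaling of $B_j$.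 Let $\rho_j\ge 0$ be smooth functions on $\mathbb R^n$, vanishing outside $4B_j$, equal to $1$ in $3B_j$, and let $\tilde r_j$ be smooth functions with values in $[0,1]$, with $\operatorname{supp}\tilde r_j\subseteq 6B_j$ and $\tilde r_j=1$ in $5B_j$; assume that, for some constant $A$, $|\nabla\rho_j(x)|+|\nabla\tilde r_j(x)|\le A(1+|x|)$ for all $j$ and $x$. Set $$r_j=\frac{\rho_j}{\sum_i\rho_i},\qquad \eta(x,u)=\sum_{j=0}^\infty\tilde r_j(x)\,r_j(u).$$ Theorem 10.1. The operator $$S_0^{\rm glob}f(x)=\int_{\mathbb R^n}\ \sup_{0<t\le1}K_t(x,u)\,\big(1-\eta(x,u)\big)\,|f(u)|\,d\gamma_\infty(u)$$ (the integrand being $0$ where $\eta(x,u)=1$) is of weak type $(1,1)$ with respect to $\gamma_\infty$: there is a constant $C>0$, depending only on $n$, $Q$ and $B$, such that for every choice of the localization as above and every $f\in L^1(\gamma_\infty)$ the function $S_0^{\rm glob}f:\mathbb R^n\to[0,\infty]$ is $\gamma_\infty$-measurable and $$\gamma_\infty\{x\in\mathbb R^n:\ S_0^{\rm glob}f(x)>\alpha\}\le\frac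 C\alpha\int_{\mathbb R^n}|f|\,d\gamma_\infty\qquad\text{for all }\alpha>0.$$ -/

import Mathlib

open MeasureTheory Metric Matrix
open scoped ContDiff

noncomputable section

namespace OrnsteinUhlenbeck

/-- Euclidean space of dimension `n`. -/
abbrev E (n : ℕ) : Type := EuclideanSpace ℝ (Fin n)

/-- All (complex) eigenvalues of the real matrix `B` have negative real part. -/
def EigenvaluesNegRe {n : ℕ} (B : Matrix (Fin n) (Fin n) ℝ) : Prop :=
  ∀ z : ℂ, Module.End.HasEigenvalue (Matrix.toLin' (B.map (algebraMap ℝ ℂ))) z → z.re < 0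

/-- The integrand `e^{sB} Q e^{sB*}` of the covariance matrices. -/
def covIntegrand {n : ℕ} (Q B : Matrix (Fin n) (Fin n) ℝ) (s : ℝ) : Matrix (Fin n) (Fin n) ℝ :=
  NormedSpace.exp (s • B) * Q * NormedSpace.exp (s • Bᵀ)

/-- `Q_t`, the integral of `e^{sB} Q e^{sB*}` over `0 < s < t`, entry by entry
(used for `0 < t < ∞`). -/
def Qt {n : ℕ} (Q B : Matrix (Fin n) (Fin n) ℝ) (t : ℝ) : Matrix (Fin n) (Fin n) ℝ :=
  Matrix.of fun i j => ∫ s in (0 : ℝ)..t, covIntegrand Q B s i j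

/-- `Q_∞`, the integral of `e^{sB} Q e^{sB*}` over `0 < s < ∞`, entry by entry. -/
def Qinf {n : ℕ} (Q B : Matrix (Fin n) (Fin n) ℝ) : Matrix (Fin n) (Fin n) ℝ :=
  Matrix.of fun i j => ∫ s in Set.Ioi (0 : ℝ), covIntegrand Q B s i j

/-- The quadratic form `⟨A x, x⟩`. -/
def quadForm {n : ℕ} (A : Matrix (Fin n) (Fin n) ℝ) (x : E n) : ℝ :=
  inner ℝ (Matrix.toEuclideanLin A x) x

/-- `R(x) = ⟨Q_∞⁻¹ x, x⟩ / 2`. -/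
def R {n : ℕ} (Q B : Matrix (Fin n) (Fin n) ℝ) (x : E n) : ℝ :=
  (1 / 2) * quadForm (Qinf Q B)⁻¹ x

/-- The invariant measure `γ_∞`: density `(2π)^{-n/2} (det Q_∞)^{-1/2} e^{-R(x)}` with respect to
Lebesgue measure. -/
def gammaInf {n : ℕ} (Q B : Matrix (Fin n) (Fin n) ℝ) : Measure (E n) :=
  volume.withDensity fun x =>
    ENNReal.ofReal ((2 * Real.pi) ^ (-(n : ℝ) / 2) * (Qinf Q B).det ^ (-(1 : ℝ) / 2) *
      Real.exp (-R Q B x))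

/-- `D_t = Q_∞ e^{-tB*} Q_∞⁻¹`. -/
def D {n : ℕ} (Q B : Matrix (Fin n) (Fin n) ℝ) (t : ℝ) : Matrix (Fin n) (Fin n) ℝ :=
  Qinf Q B * NormedSpace.exp ((-t) • Bᵀ) * (Qinf Q B)⁻¹

/-- The Mehler kernel `K_t(x,u)`, a kernel with respect to `γ_∞`. -/
def mehler {n : ℕ} (Q B : Matrix (Fin n) (Fin n) ℝ) (t : ℝ) (x u : E n) : ℝ :=
  ((Qinf Q B).det / (Qt Q B t).det) ^ ((1 : ℝ) / 2) * Real.exp (R Q B x) *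
    Real.exp (-(1 / 2) *
      quadForm ((Qt Q B t)⁻¹ - (Qinf Q B)⁻¹) (u - Matrix.toEuclideanLin (D Q B t) x))

/-- The ball with centre `c` and radius `k / (1 + |c|)`, that is, the concentric `k`-fold scaling
of the ball `B(c, 1/(1+|c|))`. -/
def scaledBall {n : ℕ} (k : ℝ) (c : E n) : Set (E n) := ball c (k / (1 + ‖c‖))

/-- The data used for localization: a maximal pairwise disjoint sequence of balls
`B_j = B(x_j, 1/(1+|x_j|))` with `x_0 = 0`, and two families of smooth cut-off functions. -/
structure Localization (n : ℕ) where
  /-- the centres `x_j` -/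
  center : ℕ → E n
  center_zero : center 0 = 0
  disjoint : Pairwise fun i j => Disjoint (scaledBall 1 (center i)) (scaledBall 1 (center j))
  /-- maximality: no further ball `B(y, 1/(1+|y|))` can be added to the family -/
  maximal : ∀ y : E n, ∃ j, ¬ Disjoint (scaledBall 1 y) (scaledBall 1 (center j))
  /-- the functions `ρ_j` -/
  rho : ℕ → E n → ℝ
  rho_smooth : ∀ j, ContDiff ℝ ∞ (rho j)
  rho_nonneg : ∀ j x, 0 ≤ rho j x
  rho_support : ∀ j, Function.support (rho j) ⊆ scaledBall 4 (center j)
  rho_eq_one : ∀ j, ∀ x ∈ scaledBall 3 (center j), rho j x = 1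
  rho_grad : ∃ A : ℝ, ∀ j x, ‖fderiv ℝ (rho j) x‖ ≤ A * (1 + ‖x‖)
  /-- the functions written `r_j` with a tilde -/
  rTilde : ℕ → E n → ℝ
  rTilde_smooth : ∀ j, ContDiff ℝ ∞ (rTilde j)
  rTilde_mem : ∀ j x, rTilde j x ∈ Set.Icc (0 : ℝ) 1
  rTilde_support : ∀ j, tsupport (rTilde j) ⊆ scaledBall 6 (center j)
  rTilde_eq_one : ∀ j, ∀ x ∈ scaledBall 5 (center j), rTilde j x = 1
  rTilde_grad : ∃ A : ℝ, ∀ j x, ‖fderiv ℝ (rTilde j) x‖ ≤ A * (1 + ‖x‖)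

namespace Localization

/-- The partition of unity `r_j = ρ_j / ∑ᵢ ρ_i`; the sum is locally finite and at least `1`. -/
def r {n : ℕ} (L : Localization n) (j : ℕ) (u : E n) : ℝ :=
  L.rho j u / ∑' i, L.rho i u

/-- `η(x,u)`, the sum over `j` of `rTilde_j(x) r_j(u)`; only finitely many terms are nonzero. -/
def eta {n : ℕ} (L : Localization n) (x u : E n) : ℝ :=
  ∑' j, L.rTilde j x * L.r j u

end Localization

/-- The global small-time maximal operator, with values in `[0,∞]`: the integral against `γ_∞` of
`sup_{0<t≤1} K_t(x,u) (1 - η(x,u)) |f(u)|`. The factor `1 - η(x,u)` stands inside the supremum, so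
that the integrand is zero where `η(x,u) = 1`, even if the supremum of `K_t(x,u)` is infinite. -/
def S0glob {n : ℕ} (Q B : Matrix (Fin n) (Fin n) ℝ) (L : Localization n) (f : E n → ℂ)
    (x : E n) : ENNReal :=
  ∫⁻ u, (⨆ t ∈ Set.Ioc (0 : ℝ) 1, ENNReal.ofReal (mehler Q B t x u * (1 - L.eta x u))) * ‖f u‖ₑ
    ∂(gammaInf Q B)

end OrnsteinUhlenbeck

end

open scoped Matrix.Norms.L2Operator

namespace OrnsteinUhlenbeck

/-! For t ≤ 1 the kernel is at most a constant times e^{R(x)} t^{-n/2} exp(-c|u - D_t x|²/t)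
(`exists_mehler_le`). The localization enters the estimates only through η ≥ 0 and η = 1 for |x - u|
< 1/(10(1+|x|)). Off that region, for every Λ ≥ 1 + |x|, the Gaussian factor is bounded uniformly in
t by a multiple of Λ^n, and also by a multiple of Λ ∫_0^2 (1/Λ + |u - D_s x|)^{-(n+1)} ds
(`exists_gaussian_flow_le`). The supremum over t thus becomes an average along the orbit of x.

The other ingredient is growth along the flow, R(D_s x) ≥ (1 + cs) R(x) (`exists_le_R_D`). The rest
is an argument about linear flows (`exists_weakType_flow`). Let N be the L¹ norm of f. If α/N is
bounded, finiteness of the measure suffices. Otherwise write α/N = e^{4ρ}. The first bound puts the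
level set inside {R ≥ ρ}, and {R > 8ρ} has mass O(e^{-4ρ}) = O(N/α). In the annulus between, 1 + |x|
≤ Λ with Λ² comparable to ρ.

Let F be the part of the annulus where the orbit-average majorant exceeds α, and F₁ the points of F
whose backward orbit, sampled at steps 1/ρ, never meets F again. Each forward step raises R by at
least a fixed amount, so a geometric series bounds the mass of F by that of F₁
(`exists_lintegral_exp_neg_le`). When the majorant is integrated over F₁, e^{R} cancels the Gaussian
density. By Fubini and z = D_s y, each z is reached from F₁ only during a set of times of measure at
most 1/ρ, and the kernel has integral O(Λ) (`exists_lintegral_flow_average_le`). The result is O(Λ ·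
Λ/ρ) N = O(N). -/

/-! ### Exponential decay of the matrix semigroup. -/

theorem exp_mulVec_of_mulVec_eq {n : ℕ} (A : Matrix (Fin n) (Fin n) ℂ) (z : ℂ) (v : Fin n → ℂ)
    (h : A *ᵥ v = z • v) : NormedSpace.exp A *ᵥ v = Complex.exp z • v := by
  have hpow : ∀ k : ℕ, (A ^ k) *ᵥ v = z ^ k • v := by
    intro k
    induction k with
    | zero => simp
    | succ k ih =>
      rw [pow_succ, ← mulVec_mulVec, h, mulVec_smul, ih, smul_smul, pow_succ, mul_comm]
  have h1 := NormedSpace.exp_series_hasSum_exp' (𝕂 := ℂ) A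
  have hc : Continuous fun M : Matrix (Fin n) (Fin n) ℂ => M *ᵥ v :=
    continuous_id.matrix_mulVec continuous_const
  have h2 := h1.map (AddMonoidHom.mk' (fun M : Matrix (Fin n) (Fin n) ℂ => M *ᵥ v)
    (fun a b => add_mulVec a b v)) hc
  have h3 := NormedSpace.exp_series_hasSum_exp' (𝕂 := ℂ) z
  have h4 := h3.smul_const v
  rw [Complex.exp_eq_exp_ℂ]
  refine h2.unique (h4.congr_fun ?_) |>.trans rfl
  intro k
  simp [smul_mulVec, hpow, smul_smul]

/-- An eigenspace of e^A is invariant under A, which commutes with e^A, so over ℂ it contains an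
eigenvector of A. -/
theorem exists_hasEigenvalue_of_mem_spectrum_exp {n : ℕ} (A : Matrix (Fin n) (Fin n) ℂ) {μ : ℂ}
    (hμ : μ ∈ spectrum ℂ (NormedSpace.exp A)) :
    ∃ z, Module.End.HasEigenvalue (Matrix.toLin' A) z ∧ Complex.exp z = μ := by
  rw [← Matrix.spectrum_toLin', ← Module.End.hasEigenvalue_iff_mem_spectrum] at hμ
  set f := Matrix.toLin' A
  set g := Matrix.toLin' (NormedSpace.exp A)
  have hcomm : Commute g f := by
    have : Commute (NormedSpace.exp A) A := (Commute.refl A).exp_left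
    change g * f = f * g
    change Matrix.toLin' _ ∘ₗ Matrix.toLin' _ = Matrix.toLin' _ ∘ₗ Matrix.toLin' _
    rw [← Matrix.toLin'_mul, ← Matrix.toLin'_mul, this.eq]
  have hmaps := Module.End.mapsTo_genEigenspace_of_comm hcomm μ 1
  let W := Module.End.eigenspace g μ
  have hW : ∀ w ∈ W, f w ∈ W := fun w hw => hmaps hw
  have : Nontrivial W := Submodule.nontrivial_iff_ne_bot.2 hμ
  obtain ⟨z, hz⟩ := Module.End.exists_eigenvalue (f.restrict hW)
  obtain ⟨⟨v, hvW⟩, hv⟩ := hz.exists_hasEigenvector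
  have hv0 : v ≠ 0 := fun h => hv.2 (by ext1; exact h)
  have hfv : f v = z • v := congrArg Subtype.val hv.apply_eq_smul
  refine ⟨z, Module.End.hasEigenvalue_of_hasEigenvector (x := v)
    ⟨Module.End.mem_eigenspace_iff.2 hfv, hv0⟩, ?_⟩
  have hgv : g v = μ • v := Module.End.mem_eigenspace_iff.1 hvW
  have h1 := exp_mulVec_of_mulVec_eq A z v (by simpa [f, Matrix.toLin'_apply] using hfv)
  have h2 : Complex.exp z • v = μ • v := by
    rw [← h1, ← hgv]; simp [g, Matrix.toLin'_apply]
  exact smul_left_injective ℂ hv0 h2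

/-- By spectral mapping the spectral radius of e^A is below 1, and Gelfand's formula then yields a
power of norm below 1. -/
theorem exists_norm_exp_pow_lt {n : ℕ} (A : Matrix (Fin n) (Fin n) ℂ)
    (hA : ∀ z, Module.End.HasEigenvalue (Matrix.toLin' A) z → z.re < 0) :
    ∃ k : ℕ, 0 < k ∧ ‖NormedSpace.exp ((k : ℝ) • A)‖ < 1 := by
  rcases Nat.eq_zero_or_pos n with rfl | hn
  · exact ⟨1, one_pos, by rw [Subsingleton.elim (NormedSpace.exp _) 0]; simp⟩
  have : Nonempty (Fin n) := ⟨⟨0, hn⟩⟩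
  have hr : spectralRadius ℂ (NormedSpace.exp A) < 1 := by
    refine spectrum.spectralRadius_lt_of_forall_lt (r := 1) _ fun μ hμ => ?_
    obtain ⟨z, hz, rfl⟩ := exists_hasEigenvalue_of_mem_spectrum_exp A hμ
    rw [← NNReal.coe_lt_coe, coe_nnnorm, Complex.norm_exp, NNReal.coe_one]
    exact Real.exp_lt_one_iff.2 (hA z hz)
  have hG := spectrum.gelfand_formula (NormedSpace.exp A)
  obtain ⟨k, hk, hk0⟩ := ((hG.eventually_lt_const hr).and (Filter.eventually_gt_atTop 0)).exists
  refine ⟨k, hk0, ?_⟩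
  have h1 : (k : ℝ) • A = k • A := by rw [Nat.cast_smul_eq_nsmul]
  rw [h1, Matrix.exp_nsmul]
  by_contra hcon
  push Not at hcon
  refine absurd hk (not_lt.2 ?_)
  refine ENNReal.one_le_rpow ?_ (by positivity)
  exact_mod_cast hcon

/-- If all eigenvalues of `A` have negative real part, then `e^{sA}` decays exponentially. -/
theorem exists_norm_exp_smul_le {n : ℕ} (A : Matrix (Fin n) (Fin n) ℂ)
    (hA : ∀ z, Module.End.HasEigenvalue (Matrix.toLin' A) z → z.re < 0) :
    ∃ C w : ℝ, 0 < C ∧ 0 < w ∧ ∀ s : ℝ, 0 ≤ s →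
      ‖NormedSpace.exp (s • A)‖ ≤ C * Real.exp (-w * s) := by
  obtain ⟨k, hk0, hk⟩ := exists_norm_exp_pow_lt A hA
  have hk0' : (0 : ℝ) < k := by exact_mod_cast hk0
  -- A number strictly between the norm and 1 is positive even if the norm vanishes, so its
  -- logarithm is available.
  obtain ⟨q, hq, hq1⟩ : ∃ q : ℝ, 0 < q ∧ ‖NormedSpace.exp ((k : ℝ) • A)‖ ≤ Real.exp (-q) := by
    obtain ⟨p, hp1, hp2⟩ := exists_between hk
    have hp0 : 0 < p := (norm_nonneg _).trans_lt hp1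
    exact ⟨-Real.log p, by linarith [Real.log_neg hp0 hp2],
      by rw [neg_neg, Real.exp_log hp0]; exact hp1.le⟩
  have hcont : Continuous fun s : ℝ => NormedSpace.exp (s • A) :=
    continuous_iff_continuousAt.2 fun s => (hasDerivAt_exp_smul_const (𝕂 := ℝ) A s).continuousAt
  obtain ⟨C, hC⟩ := isCompact_Icc (a := (0 : ℝ)) (b := k) |>.exists_bound_of_continuousOn
    hcont.continuousOn
  have hC0 : 0 ≤ C := (norm_nonneg _).trans (hC 0 ⟨le_rfl, hk0'.le⟩)
  refine ⟨(C + 1) * Real.exp q, q / k, by positivity, by positivity, fun s hs => ?_⟩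
  set m := ⌊s / k⌋₊
  have hm1 : (m : ℝ) ≤ s / k := Nat.floor_le (by positivity)
  have hm2 : s / k < m + 1 := Nat.lt_floor_add_one _
  have hm1' : m * (k : ℝ) ≤ s := by rwa [le_div_iff₀ hk0'] at hm1
  have hm2' : s < (m + 1) * (k : ℝ) := by rwa [div_lt_iff₀ hk0'] at hm2
  have hsplit : s • A = m • ((k : ℝ) • A) + (s - m * k) • A := by
    rw [← Nat.cast_smul_eq_nsmul ℝ, smul_smul, ← add_smul]; congr 1; ring
  have hc : Commute (m • ((k : ℝ) • A)) ((s - m * k) • A) :=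
    (((Commute.refl A).smul_left _).smul_left _).smul_right _
  rw [hsplit, Matrix.exp_add_of_commute _ _ hc, Matrix.exp_nsmul]
  have hb : ‖NormedSpace.exp ((s - m * k) • A)‖ ≤ C :=
    hC _ ⟨by linarith, by linarith⟩
  have ha : ‖NormedSpace.exp ((k : ℝ) • A) ^ m‖ ≤ Real.exp (-q * m) ∨ m = 0 := by
    rcases Nat.eq_zero_or_pos m with h | h
    · exact Or.inr h
    · left
      refine (norm_pow_le' _ h).trans ?_
      rw [mul_comm, Real.exp_nat_mul]
      exact pow_le_pow_left₀ (norm_nonneg _) hq1 _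
  have hfin : Real.exp (-q * m) ≤ Real.exp q * Real.exp (-(q / k) * s) := by
    rw [← Real.exp_add]
    apply Real.exp_le_exp.2
    have : q * (s / k) ≤ q * (m + 1) := mul_le_mul_of_nonneg_left hm2.le hq.le
    have e : q / k * s = q * (s / k) := by ring
    nlinarith
  rcases ha with ha | ha
  · calc _ ≤ Real.exp (-q * m) * C :=
        (norm_mul_le _ _).trans (mul_le_mul ha hb (norm_nonneg _) (Real.exp_pos _).le)
      _ ≤ (Real.exp q * Real.exp (-(q / k) * s)) * (C + 1) := by
        gcongr; linarith
      _ = _ := by ring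
  · rw [ha, pow_zero, one_mul]
    rw [ha] at hfin
    simp only [Nat.cast_zero, mul_zero, Real.exp_zero] at hfin
    calc _ ≤ (C + 1) * 1 := by
          have : (m : ℝ) = 0 := by exact_mod_cast ha
          rw [this] at hb; simp only [Nat.cast_zero]; linarith
      _ ≤ (C + 1) * (Real.exp q * Real.exp (-(q / k) * s)) := by gcongr
      _ = _ := by ring

theorem exp_map_ofReal {n : ℕ} (B : Matrix (Fin n) (Fin n) ℝ) :
    NormedSpace.exp (B.map (algebraMap ℝ ℂ)) = (NormedSpace.exp B).map (algebraMap ℝ ℂ) := by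
  let _ : NormedAlgebra ℚ (Matrix (Fin n) (Fin n) ℝ) := NormedAlgebra.restrictScalars ℚ ℝ _
  have := NormedSpace.map_exp ((algebraMap ℝ ℂ).mapMatrix (m := Fin n))
    (by exact Continuous.matrix_map continuous_id Complex.continuous_ofReal) B
  simpa using this.symm

theorem abs_entry_le_norm {n : ℕ} (A : Matrix (Fin n) (Fin n) ℂ) (i j : Fin n) :
    ‖A i j‖ ≤ ‖A‖ := by
  have h := (toEuclideanCLM (𝕜 := ℂ) A).le_opNorm (EuclideanSpace.single j 1)
  have h2 : ‖(toEuclideanCLM (𝕜 := ℂ) A) (EuclideanSpace.single j 1) i‖ ≤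
      ‖(toEuclideanCLM (𝕜 := ℂ) A) (EuclideanSpace.single j 1)‖ := PiLp.norm_apply_le _ i
  have h3 : (toEuclideanCLM (𝕜 := ℂ) A) (EuclideanSpace.single j 1) i = A i j := by
    simp
  rw [h3] at h2
  refine h2.trans (h.trans ?_)
  rw [PiLp.norm_single]
  simp
  rfl

theorem EigenvaluesNegRe.exists_abs_exp_le {n : ℕ} {B : Matrix (Fin n) (Fin n) ℝ}
    (hB : EigenvaluesNegRe B) :
    ∃ C w : ℝ, 0 < C ∧ 0 < w ∧ ∀ s : ℝ, 0 ≤ s → ∀ i j,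
      |NormedSpace.exp (s • B) i j| ≤ C * Real.exp (-w * s) := by
  obtain ⟨C, w, hC, hw, h⟩ := exists_norm_exp_smul_le _ hB
  refine ⟨C, w, hC, hw, fun s hs i j => ?_⟩
  refine le_trans ?_ (h s hs)
  refine le_trans (le_of_eq ?_) (abs_entry_le_norm _ i j)
  have : s • B.map (algebraMap ℝ ℂ) = (s • B).map (algebraMap ℝ ℂ) := by
    ext i j; simp
  rw [this, exp_map_ofReal]
  simp

/-! ### Quadratic forms of positive definite matrices. -/

section QuadraticForms

variable {n : ℕ}

theorem toEuclideanCLM_mul_apply (A M : Matrix (Fin n) (Fin n) ℝ) (x : E n) :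
    toEuclideanCLM (𝕜 := ℝ) (A * M) x = toEuclideanCLM (𝕜 := ℝ) A (toEuclideanCLM (𝕜 := ℝ) M x) := by
  rw [map_mul]; rfl

theorem inner_toEuclideanCLM_left (A : Matrix (Fin n) (Fin n) ℝ) (x y : E n) :
    inner ℝ (toEuclideanCLM (𝕜 := ℝ) A x) y = inner ℝ x (toEuclideanCLM (𝕜 := ℝ) Aᵀ y) := by
  have : toEuclideanCLM (𝕜 := ℝ) Aᵀ = (toEuclideanCLM (𝕜 := ℝ) A).adjoint := by
    rw [← ContinuousLinearMap.star_eq_adjoint, ← map_star]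
    rw [star_eq_conjTranspose, conjTranspose_eq_transpose_of_trivial]
  rw [this, ContinuousLinearMap.adjoint_inner_right]

theorem quadForm_def (A : Matrix (Fin n) (Fin n) ℝ) (x : E n) :
    quadForm A x = inner ℝ (toEuclideanCLM (𝕜 := ℝ) A x) x := rfl

theorem quadForm_eq_sum (A : Matrix (Fin n) (Fin n) ℝ) (x : E n) :
    quadForm A x = ∑ i, ∑ j, x i * x j * A i j := by
  rw [quadForm_def, EuclideanSpace.inner_eq_star_dotProduct]
  simp only [dotProduct, ofLp_toEuclideanCLM, mulVec, star_trivial, Pi.star_apply, Finset.mul_sum]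
  refine Finset.sum_congr rfl fun i _ => Finset.sum_congr rfl fun j _ => ?_
  ring

theorem quadForm_sub (A M : Matrix (Fin n) (Fin n) ℝ) (x : E n) :
    quadForm (A - M) x = quadForm A x - quadForm M x := by
  simp only [quadForm_def, map_sub, _root_.sub_apply, inner_sub_left]

theorem quadForm_conj (A M : Matrix (Fin n) (Fin n) ℝ) (x : E n) :
    quadForm (Mᵀ * A * M) x = quadForm A (toEuclideanCLM (𝕜 := ℝ) M x) := by
  rw [quadForm_def, quadForm_def, toEuclideanCLM_mul_apply, toEuclideanCLM_mul_apply,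
    inner_toEuclideanCLM_left, transpose_transpose]

theorem quadForm_le (A : Matrix (Fin n) (Fin n) ℝ) (x : E n) :
    quadForm A x ≤ ‖A‖ * ‖x‖ ^ 2 := by
  rw [quadForm_def]
  refine (real_inner_le_norm _ _).trans ?_
  have h : ‖toEuclideanCLM (𝕜 := ℝ) A x‖ ≤ ‖A‖ * ‖x‖ :=
    (toEuclideanCLM (𝕜 := ℝ) A).le_opNorm x
  nlinarith [norm_nonneg x]

theorem quadForm_pos {A : Matrix (Fin n) (Fin n) ℝ} (hA : A.PosDef) {x : E n} (hx : x ≠ 0) :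
    0 < quadForm A x := by
  have h := hA.re_dotProduct_pos (x := x.ofLp) (by simpa using hx)
  have e : quadForm A x = star x.ofLp ⬝ᵥ A *ᵥ x.ofLp := by
    rw [quadForm_eq_sum]
    simp only [dotProduct, mulVec, star_trivial, Finset.mul_sum]
    refine Finset.sum_congr rfl fun i _ => Finset.sum_congr rfl fun j _ => ?_
    ring
  rw [e]
  exact h

theorem quadForm_nonneg {A : Matrix (Fin n) (Fin n) ℝ} (hA : A.PosDef) (x : E n) :
    0 ≤ quadForm A x := by
  rcases eq_or_ne x 0 with rfl | hx
  · simp [quadForm_def]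
  · exact (quadForm_pos hA hx).le

theorem posDef_of_quadForm {A : Matrix (Fin n) (Fin n) ℝ} (hs : Aᵀ = A)
    (h : ∀ x : E n, x ≠ 0 → 0 < quadForm A x) : A.PosDef := by
  refine PosDef.of_dotProduct_mulVec_pos (by
    rw [IsHermitian, conjTranspose_eq_transpose_of_trivial, hs]) fun x hx => ?_
  have e := h (WithLp.toLp 2 x) (by simpa using hx)
  rw [quadForm_eq_sum] at e
  refine e.trans_eq ?_
  simp only [dotProduct, mulVec, star_trivial, Finset.mul_sum]
  refine Finset.sum_congr rfl fun i _ => Finset.sum_congr rfl fun j _ => ?_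
  ring

theorem quadForm_smul_vec (A : Matrix (Fin n) (Fin n) ℝ) (r : ℝ) (x : E n) :
    quadForm A (r • x) = r ^ 2 * quadForm A x := by
  simp only [quadForm_def, map_smul, inner_smul_left, inner_smul_right]
  simp; ring

theorem continuous_quadForm (A : Matrix (Fin n) (Fin n) ℝ) :
    Continuous fun x : E n => quadForm A x := by
  simp only [quadForm_def]
  fun_prop

/-- The constant is the minimum over the unit sphere, extended by homogeneity; the sphere is empty
in dimension 0. -/
theorem exists_le_quadForm {A : Matrix (Fin n) (Fin n) ℝ} (hA : A.PosDef) :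
    ∃ c : ℝ, 0 < c ∧ ∀ x : E n, c * ‖x‖ ^ 2 ≤ quadForm A x := by
  rcases (sphere (0 : E n) 1).eq_empty_or_nonempty with he | hne
  · refine ⟨1, one_pos, fun x => ?_⟩
    have : x = 0 := by
      by_contra hx
      have : (‖x‖⁻¹ • x) ∈ sphere (0 : E n) 1 := by
        simp [norm_smul, hx]
      rw [he] at this
      exact this
    simp [this, quadForm_def]
  · obtain ⟨z, hz, hmin⟩ := (isCompact_sphere (0 : E n) 1).exists_isMinOn hne
      (continuous_quadForm A).continuousOn
    have hz1 : ‖z‖ = 1 := by simpa using hz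
    refine ⟨quadForm A z, quadForm_pos hA (by rintro rfl; simp at hz1), fun x => ?_⟩
    rcases eq_or_ne x 0 with rfl | hx
    · simp [quadForm_def]
    have hx' : 0 < ‖x‖ := norm_pos_iff.2 hx
    have h1 : quadForm A z ≤ quadForm A (‖x‖⁻¹ • x) :=
      hmin (by simp [norm_smul, hx])
    rw [quadForm_smul_vec] at h1
    calc quadForm A z * ‖x‖ ^ 2 ≤ (‖x‖⁻¹ ^ 2 * quadForm A x) * ‖x‖ ^ 2 := by gcongr
      _ = quadForm A x := by field_simp

/-- Inversion is antitone on positive definite quadratic forms. -/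
theorem quadForm_inv_le {A P : Matrix (Fin n) (Fin n) ℝ} (hA : A.PosDef) (hP : P.PosDef) {θ : ℝ}
    (hθ : 0 < θ) (h : ∀ x, quadForm A x ≤ θ * quadForm P x) (x : E n) :
    quadForm P⁻¹ x ≤ θ * quadForm A⁻¹ x := by
  have hAs : Aᵀ = A := by
    have := hA.1; rwa [IsHermitian, conjTranspose_eq_transpose_of_trivial] at this
  set z := toEuclideanCLM (𝕜 := ℝ) P⁻¹ x
  set w := toEuclideanCLM (𝕜 := ℝ) A⁻¹ x
  have hz : toEuclideanCLM (𝕜 := ℝ) P z = x := by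
    rw [← toEuclideanCLM_mul_apply, mul_nonsing_inv _ ((isUnit_iff_isUnit_det _).1 hP.isUnit)]
    simp
  have hw : toEuclideanCLM (𝕜 := ℝ) A w = x := by
    rw [← toEuclideanCLM_mul_apply, mul_nonsing_inv _ ((isUnit_iff_isUnit_det _).1 hA.isUnit)]
    simp
  -- Expanding the `A`-form at θA⁻¹x - P⁻¹x and bounding its last term by θ times the `P`-form gives
  -- the claim after division by θ.
  have h0 := quadForm_nonneg hA (θ • w - z)
  have hPz : quadForm P z = quadForm P⁻¹ x := by
    rw [quadForm_def, hz, quadForm_def, real_inner_comm]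
  have hAw : inner ℝ x w = quadForm A⁻¹ x := by
    rw [quadForm_def, real_inner_comm]
  have hxz : inner ℝ x z = quadForm P⁻¹ x := by
    rw [quadForm_def, real_inner_comm]
  have h1 := h z
  have hAz : inner ℝ (toEuclideanCLM (𝕜 := ℝ) A z) w = inner ℝ x z := by
    rw [inner_toEuclideanCLM_left, hAs, hw, real_inner_comm]
  have e : quadForm A (θ • w - z) =
      θ ^ 2 * quadForm A⁻¹ x - 2 * θ * quadForm P⁻¹ x + quadForm A z := by
    rw [quadForm_def, map_sub, map_smul, hw]
    simp only [inner_sub_left, inner_sub_right, inner_smul_left, inner_smul_right, hAz, hAw, hxz,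
      quadForm_def A z]
    simp; ring
  rw [hPz] at h1
  have : 0 ≤ θ * (θ * quadForm A⁻¹ x - quadForm P⁻¹ x) := by nlinarith
  have := nonneg_of_mul_nonneg_right this hθ
  linarith

theorem pow_le_det {A : Matrix (Fin n) (Fin n) ℝ} (hA : A.PosDef) {c : ℝ} (hc : 0 ≤ c)
    (h : ∀ x : E n, c * ‖x‖ ^ 2 ≤ quadForm A x) : c ^ n ≤ A.det := by
  rw [hA.1.det_eq_prod_eigenvalues]
  have : ∀ i, c ≤ hA.1.eigenvalues i := by
    intro i
    have h1 := h (hA.1.eigenvectorBasis i)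
    have h2 : ‖hA.1.eigenvectorBasis i‖ = 1 := hA.1.eigenvectorBasis.orthonormal.1 i
    have h3 : toEuclideanCLM (𝕜 := ℝ) A (hA.1.eigenvectorBasis i) =
        hA.1.eigenvalues i • hA.1.eigenvectorBasis i := by
      have := hA.1.mulVec_eigenvectorBasis i
      ext j
      have h4 := congrFun this j
      simpa using h4
    rw [quadForm_def, h3, inner_smul_left, real_inner_self_eq_norm_sq, h2] at h1
    simpa using h1
  calc c ^ n = ∏ i : Fin n, c := by simp
    _ ≤ ∏ i, hA.1.eigenvalues i := Finset.prod_le_prod (fun _ _ => hc) fun i _ => this i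
    _ = _ := by simp

end QuadraticForms

/-! ### The covariance matrices Q_t and Q_∞. -/

section Covariance

variable {n : ℕ}

/-- The adjoint semigroup `e^{sB*}` acting on Euclidean space. -/
noncomputable def adjFlow (B : Matrix (Fin n) (Fin n) ℝ) (s : ℝ) : E n →L[ℝ] E n :=
  toEuclideanCLM (𝕜 := ℝ) (NormedSpace.exp (s • Bᵀ))

theorem exp_add_smul (A : Matrix (Fin n) (Fin n) ℝ) (s t : ℝ) :
    NormedSpace.exp ((s + t) • A) = NormedSpace.exp (s • A) * NormedSpace.exp (t • A) := by
  rw [add_smul, Matrix.exp_add_of_commute]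
  exact ((Commute.refl A).smul_left _).smul_right _

theorem continuous_exp_smul (A : Matrix (Fin n) (Fin n) ℝ) :
    Continuous fun s : ℝ => NormedSpace.exp (s • A) :=
  continuous_iff_continuousAt.2 fun s => (hasDerivAt_exp_smul_const (𝕂 := ℝ) A s).continuousAt

theorem adjFlow_add (B : Matrix (Fin n) (Fin n) ℝ) (s t : ℝ) (x : E n) :
    adjFlow B (s + t) x = adjFlow B s (adjFlow B t x) := by
  rw [adjFlow, exp_add_smul, toEuclideanCLM_mul_apply]; rfl

theorem adjFlow_zero (B : Matrix (Fin n) (Fin n) ℝ) (x : E n) : adjFlow B 0 x = x := by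
  simp [adjFlow]

theorem exists_norm_adjFlow_le (B : Matrix (Fin n) (Fin n) ℝ) :
    ∃ C : ℝ, 0 < C ∧ ∀ s ∈ Set.Icc (-1 : ℝ) 1, ∀ x : E n, ‖adjFlow B s x‖ ≤ C * ‖x‖ := by
  obtain ⟨C, hC⟩ := isCompact_Icc (a := (-1 : ℝ)) (b := 1) |>.exists_bound_of_continuousOn
    (continuous_exp_smul Bᵀ).continuousOn
  have hC0 : 0 ≤ C := (norm_nonneg _).trans (hC 0 (by norm_num))
  refine ⟨C + 1, by linarith, fun s hs x => ?_⟩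
  have h : ‖adjFlow B s x‖ ≤ ‖NormedSpace.exp (s • Bᵀ)‖ * ‖x‖ :=
    (adjFlow B s).le_opNorm x
  refine h.trans ?_
  gcongr
  linarith [hC s hs]

theorem exists_le_norm_adjFlow (B : Matrix (Fin n) (Fin n) ℝ) :
    ∃ c : ℝ, 0 < c ∧ ∀ s ∈ Set.Icc (-1 : ℝ) 1, ∀ x : E n, c * ‖x‖ ≤ ‖adjFlow B s x‖ := by
  obtain ⟨C, hC, h⟩ := exists_norm_adjFlow_le B
  refine ⟨C⁻¹, by positivity, fun s hs x => ?_⟩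
  have h1 := h (-s) ⟨by linarith [hs.2], by linarith [hs.1]⟩ (adjFlow B s x)
  rw [← adjFlow_add, neg_add_cancel, adjFlow_zero] at h1
  rwa [inv_mul_le_iff₀ hC]

theorem covIntegrand_eq (Q B : Matrix (Fin n) (Fin n) ℝ) (s : ℝ) :
    covIntegrand Q B s = (NormedSpace.exp (s • Bᵀ))ᵀ * Q * NormedSpace.exp (s • Bᵀ) := by
  rw [covIntegrand, ← Matrix.exp_transpose, transpose_smul, transpose_transpose]

theorem quadForm_covIntegrand (Q B : Matrix (Fin n) (Fin n) ℝ) (s : ℝ) (x : E n) :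
    quadForm (covIntegrand Q B s) x = quadForm Q (adjFlow B s x) := by
  rw [covIntegrand_eq, quadForm_conj]; rfl

theorem transpose_covIntegrand {Q : Matrix (Fin n) (Fin n) ℝ} (hQ : Qᵀ = Q)
    (B : Matrix (Fin n) (Fin n) ℝ) (s : ℝ) :
    (covIntegrand Q B s)ᵀ = covIntegrand Q B s := by
  rw [covIntegrand_eq]
  simp only [transpose_mul, transpose_transpose, hQ, Matrix.mul_assoc]

theorem continuous_covIntegrand (Q B : Matrix (Fin n) (Fin n) ℝ) :
    Continuous (covIntegrand Q B) :=
  ((continuous_exp_smul B).mul continuous_const).mul (continuous_exp_smul Bᵀ)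

theorem continuous_covIntegrand_apply (Q B : Matrix (Fin n) (Fin n) ℝ) (i j : Fin n) :
    Continuous fun s => covIntegrand Q B s i j :=
  (continuous_covIntegrand Q B).matrix_elem i j

theorem integrableOn_covIntegrand (Q : Matrix (Fin n) (Fin n) ℝ) {B : Matrix (Fin n) (Fin n) ℝ}
    (hB : EigenvaluesNegRe B) (i j : Fin n) :
    IntegrableOn (fun s => covIntegrand Q B s i j) (Set.Ioi 0) := by
  obtain ⟨C, w, hC, hw, h⟩ := hB.exists_abs_exp_le
  have hint : IntegrableOn (fun s => (∑ k, ∑ l, C * |Q l k| * C) * Real.exp (-w * s))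
      (Set.Ioi 0) := (integrableOn_exp_mul_Ioi (by linarith) 0).const_mul _
  refine Integrable.mono' hint
    (continuous_covIntegrand_apply Q B i j).aestronglyMeasurable ?_
  filter_upwards [ae_restrict_mem measurableSet_Ioi] with s hs
  have hs0 : (0 : ℝ) ≤ s := (Set.mem_Ioi.1 hs).le
  have he1 : Real.exp (-w * s) ≤ 1 := Real.exp_le_one_iff.2 (by nlinarith)
  have hBt : ∀ k, NormedSpace.exp (s • Bᵀ) k j = NormedSpace.exp (s • B) j k := by
    intro k
    rw [← transpose_smul, Matrix.exp_transpose, transpose_apply]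
  rw [covIntegrand, mul_apply, Real.norm_eq_abs]
  simp only [mul_apply, Finset.sum_mul, hBt]
  refine (Finset.abs_sum_le_sum_abs _ _).trans (Finset.sum_le_sum fun k _ => ?_)
  refine (Finset.abs_sum_le_sum_abs _ _).trans (Finset.sum_le_sum fun l _ => ?_)
  rw [abs_mul, abs_mul]
  calc |NormedSpace.exp (s • B) i l| * |Q l k| * |NormedSpace.exp (s • B) j k|
      ≤ (C * Real.exp (-w * s)) * |Q l k| * (C * 1) := by
        gcongr
        · exact h s hs0 i l
        · exact (h s hs0 j k).trans (by gcongr)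
    _ = _ := by ring

theorem quadForm_Qt (Q B : Matrix (Fin n) (Fin n) ℝ) (t : ℝ) (x : E n) :
    quadForm (Qt Q B t) x = ∫ s in (0 : ℝ)..t, quadForm Q (adjFlow B s x) := by
  simp_rw [← quadForm_covIntegrand, quadForm_eq_sum]
  rw [intervalIntegral.integral_finsetSum]
  · refine Finset.sum_congr rfl fun i _ => ?_
    rw [intervalIntegral.integral_finsetSum]
    · refine Finset.sum_congr rfl fun j _ => ?_
      rw [intervalIntegral.integral_const_mul]; rfl
    · intro j _
      exact ((continuous_covIntegrand_apply Q B i j).const_mul _).intervalIntegrable _ _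
  · intro i _
    exact (continuous_finsetSum _ fun j _ =>
      (continuous_covIntegrand_apply Q B i j).const_mul _).intervalIntegrable _ _

theorem integrableOn_quadForm_adjFlow (Q : Matrix (Fin n) (Fin n) ℝ)
    {B : Matrix (Fin n) (Fin n) ℝ} (hB : EigenvaluesNegRe B) (x : E n) :
    IntegrableOn (fun s => quadForm Q (adjFlow B s x)) (Set.Ioi 0) := by
  simp_rw [← quadForm_covIntegrand, quadForm_eq_sum]
  exact integrable_finsetSum _ fun i _ => integrable_finsetSum _ fun j _ =>
    (integrableOn_covIntegrand Q hB i j).const_mul _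

theorem quadForm_Qinf (Q : Matrix (Fin n) (Fin n) ℝ) {B : Matrix (Fin n) (Fin n) ℝ}
    (hB : EigenvaluesNegRe B) (x : E n) :
    quadForm (Qinf Q B) x = ∫ s in Set.Ioi (0 : ℝ), quadForm Q (adjFlow B s x) := by
  simp_rw [← quadForm_covIntegrand, quadForm_eq_sum]
  rw [integral_finsetSum]
  · refine Finset.sum_congr rfl fun i _ => ?_
    rw [integral_finsetSum]
    · refine Finset.sum_congr rfl fun j _ => ?_
      rw [integral_const_mul]; rfl
    · intro j _
      exact (integrableOn_covIntegrand Q hB i j).const_mul _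
  · intro i _
    exact integrable_finsetSum _ fun j _ => (integrableOn_covIntegrand Q hB i j).const_mul _

/-- Splitting the integral at t gives Q_∞ = Q_t + e^{tB} Q_∞ e^{tB*}. Both the lower bound for Q_t⁻¹
- Q_∞⁻¹ and the growth of R along D_s come from this identity. -/
theorem quadForm_Qinf_eq_add (Q : Matrix (Fin n) (Fin n) ℝ) {B : Matrix (Fin n) (Fin n) ℝ}
    (hB : EigenvaluesNegRe B) {t : ℝ} (ht : 0 ≤ t) (x : E n) :
    quadForm (Qinf Q B) x = quadForm (Qt Q B t) x + quadForm (Qinf Q B) (adjFlow B t x) := by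
  rw [quadForm_Qinf Q hB, quadForm_Qinf Q hB, quadForm_Qt]
  simp_rw [← adjFlow_add]
  have h1 : ∫ s in Set.Ioi (0 : ℝ), quadForm Q (adjFlow B (s + t) x) =
      ∫ s in Set.Ioi t, quadForm Q (adjFlow B s x) := by
    have hmp : MeasurePreserving (fun s : ℝ => s + t) volume volume :=
      measurePreserving_add_right volume t
    have := hmp.setIntegral_preimage_emb (measurableEmbedding_addRight t)
      (fun s => quadForm Q (adjFlow B s x)) (Set.Ioi t)
    rw [← this]
    congr 2
    ext s; simp
  rw [h1]
  have hint := integrableOn_quadForm_adjFlow Q hB x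
  exact (intervalIntegral.integral_interval_add_Ioi hint
    (hint.mono_set (Set.Ioi_subset_Ioi ht))).symm

theorem transpose_Qt {Q : Matrix (Fin n) (Fin n) ℝ} (hQ : Qᵀ = Q)
    (B : Matrix (Fin n) (Fin n) ℝ) (t : ℝ) : (Qt Q B t)ᵀ = Qt Q B t := by
  ext i j
  simp only [Qt, transpose_apply, of_apply]
  congr 1 with s
  exact congrFun (congrFun (transpose_covIntegrand hQ B s) i) j

theorem transpose_Qinf {Q : Matrix (Fin n) (Fin n) ℝ} (hQ : Qᵀ = Q)
    (B : Matrix (Fin n) (Fin n) ℝ) : (Qinf Q B)ᵀ = Qinf Q B := by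
  ext i j
  simp only [Qinf, transpose_apply, of_apply]
  congr 1 with s
  exact congrFun (congrFun (transpose_covIntegrand hQ B s) i) j

theorem continuous_adjFlow_apply (B : Matrix (Fin n) (Fin n) ℝ) (x : E n) :
    Continuous fun s => adjFlow B s x := by
  have h : Continuous fun s : ℝ => (NormedSpace.exp (s • Bᵀ)) *ᵥ x.ofLp :=
    (continuous_exp_smul Bᵀ).matrix_mulVec continuous_const
  exact (PiLp.continuous_toLp 2 _).comp h

/-- `Q_t` is comparable with `t` times the identity for small `t`. -/
theorem exists_quadForm_Qt_bounds {Q : Matrix (Fin n) (Fin n) ℝ} (hQ : Q.PosDef)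
    (B : Matrix (Fin n) (Fin n) ℝ) :
    ∃ c C : ℝ, 0 < c ∧ 0 < C ∧ ∀ t, 0 ≤ t → t ≤ 1 → ∀ x : E n,
      c * t * ‖x‖ ^ 2 ≤ quadForm (Qt Q B t) x ∧ quadForm (Qt Q B t) x ≤ C * t * ‖x‖ ^ 2 := by
  obtain ⟨q, hq, hql⟩ := exists_le_quadForm hQ
  obtain ⟨a, ha, hal⟩ := exists_le_norm_adjFlow B
  obtain ⟨b, hb, hbl⟩ := exists_norm_adjFlow_le B
  refine ⟨q * a ^ 2, (‖Q‖ + 1) * b ^ 2, by positivity, by positivity, fun t ht ht1 x => ?_⟩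
  have hcont : Continuous fun s => quadForm Q (adjFlow B s x) :=
    (continuous_quadForm Q).comp (continuous_adjFlow_apply B x)
  have hmem : ∀ s ∈ Set.Icc 0 t, s ∈ Set.Icc (-1 : ℝ) 1 := fun s hs =>
    ⟨by linarith [hs.1], hs.2.trans ht1⟩
  rw [quadForm_Qt]
  constructor
  · have h := intervalIntegral.integral_mono_on (μ := volume) ht
      (f := fun _ => q * (a * ‖x‖) ^ 2)
      (g := fun s => quadForm Q (adjFlow B s x)) (continuous_const.intervalIntegrable _ _)
      (hcont.intervalIntegrable _ _) fun s hs => by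
        refine le_trans ?_ (hql _)
        gcongr
        exact hal s (hmem s hs) x
    rw [intervalIntegral.integral_const] at h
    simp only [sub_zero, smul_eq_mul] at h
    linarith
  · have h := intervalIntegral.integral_mono_on (μ := volume) ht
      (f := fun s => quadForm Q (adjFlow B s x)) (g := fun _ => (‖Q‖ + 1) * (b * ‖x‖) ^ 2)
      (hcont.intervalIntegrable _ _) (continuous_const.intervalIntegrable _ _) fun s hs => by
        refine (quadForm_le _ _).trans ?_
        gcongr
        · linarith
        · exact hbl s (hmem s hs) x
    rw [intervalIntegral.integral_const] at h
    simp only [sub_zero, smul_eq_mul] at h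
    linarith

theorem transpose_of_posDef {A : Matrix (Fin n) (Fin n) ℝ} (hA : A.PosDef) : Aᵀ = A := by
  have := hA.1; rwa [IsHermitian, conjTranspose_eq_transpose_of_trivial] at this

theorem posDef_Qt {Q : Matrix (Fin n) (Fin n) ℝ} (hQ : Q.PosDef)
    (B : Matrix (Fin n) (Fin n) ℝ) {t : ℝ} (ht : 0 < t) (ht1 : t ≤ 1) : (Qt Q B t).PosDef := by
  obtain ⟨c, C, hc, -, h⟩ := exists_quadForm_Qt_bounds hQ B
  refine posDef_of_quadForm (transpose_Qt (transpose_of_posDef hQ) B t) fun x hx => ?_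
  have hx' : 0 < ‖x‖ := norm_pos_iff.2 hx
  exact lt_of_lt_of_le (by positivity) (h t ht.le ht1 x).1

theorem quadForm_Qinf_nonneg {Q : Matrix (Fin n) (Fin n) ℝ} (hQ : Q.PosDef)
    {B : Matrix (Fin n) (Fin n) ℝ} (hB : EigenvaluesNegRe B) (x : E n) :
    0 ≤ quadForm (Qinf Q B) x := by
  rw [quadForm_Qinf Q hB]
  exact integral_nonneg fun s => quadForm_nonneg hQ _

theorem posDef_Qinf {Q : Matrix (Fin n) (Fin n) ℝ} (hQ : Q.PosDef)
    {B : Matrix (Fin n) (Fin n) ℝ} (hB : EigenvaluesNegRe B) : (Qinf Q B).PosDef := by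
  refine posDef_of_quadForm (transpose_Qinf (transpose_of_posDef hQ) B) fun x hx => ?_
  rw [quadForm_Qinf_eq_add Q hB zero_le_one]
  have h1 := quadForm_pos (posDef_Qt hQ B one_pos le_rfl) hx
  linarith [quadForm_Qinf_nonneg hQ hB (adjFlow B 1 x)]

/-- The quadratic form of `Q_t⁻¹ - Q_∞⁻¹` is at least of order `1 / t` for small `t`. -/
theorem exists_le_quadForm_inv_sub_inv {Q : Matrix (Fin n) (Fin n) ℝ} (hQ : Q.PosDef)
    {B : Matrix (Fin n) (Fin n) ℝ} (hB : EigenvaluesNegRe B) :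
    ∃ c : ℝ, 0 < c ∧ ∀ t, 0 < t → t ≤ 1 → ∀ x : E n,
      c / t * ‖x‖ ^ 2 ≤ quadForm ((Qt Q B t)⁻¹ - (Qinf Q B)⁻¹) x := by
  obtain ⟨_, C, _, hC, hQt⟩ := exists_quadForm_Qt_bounds hQ B
  have hPinf := posDef_Qinf hQ hB
  obtain ⟨p, hp, hpl⟩ := exists_le_quadForm hPinf
  obtain ⟨a, ha, hal⟩ := exists_le_norm_adjFlow B
  -- This ε makes εQ_∞ ≤ e^{tB} Q_∞ e^{tB*} for all t ≤ 1, hence Q_t ≤ (1 - ε)Q_∞; the cap 1/2 keeps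
  -- 1 - ε positive. Inverting leaves Q_t⁻¹ - Q_∞⁻¹ ≥ εQ_t⁻¹, which is at least ε/(Ct).
  set ε : ℝ := min (1 / 2) (p * a ^ 2 / (‖Qinf Q B‖ + 1)) with hε
  have hε0 : 0 < ε := by positivity
  have hε1 : ε ≤ 1 / 2 := min_le_left _ _
  have hε2 : ε * (‖Qinf Q B‖ + 1) ≤ p * a ^ 2 := by
    rw [← le_div_iff₀ (by positivity)]; exact min_le_right _ _
  refine ⟨ε / C, by positivity, fun t ht ht1 x => ?_⟩
  have hPt := posDef_Qt hQ B ht ht1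
  have h1 : ∀ y : E n, quadForm (Qt Q B t) y ≤ (1 - ε) * quadForm (Qinf Q B) y := by
    intro y
    have e := quadForm_Qinf_eq_add Q hB ht.le y
    have h2 := hpl (adjFlow B t y)
    have h3 : (a * ‖y‖) ^ 2 ≤ ‖adjFlow B t y‖ ^ 2 := by
      gcongr
      exact hal t ⟨by linarith, ht1⟩ y
    have h4 := quadForm_le (Qinf Q B) y
    have h5 : ε * quadForm (Qinf Q B) y ≤ p * (a * ‖y‖) ^ 2 := by
      calc _ ≤ ε * ((‖Qinf Q B‖ + 1) * ‖y‖ ^ 2) := by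
            gcongr; refine h4.trans ?_; gcongr; linarith
        _ = ε * (‖Qinf Q B‖ + 1) * ‖y‖ ^ 2 := by ring
        _ ≤ p * a ^ 2 * ‖y‖ ^ 2 := by gcongr
        _ = _ := by ring
    nlinarith
  have h6 := quadForm_inv_le hPt hPinf (by linarith) h1 x
  have h7 := quadForm_inv_le hPt (PosDef.one (n := Fin n) (R := ℝ)) (θ := C * t) (by positivity)
    (fun y => by
      have : quadForm (1 : Matrix (Fin n) (Fin n) ℝ) y = ‖y‖ ^ 2 := by
        rw [quadForm_def, map_one]; exact real_inner_self_eq_norm_sq y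
      rw [this]; exact (hQt t ht.le ht1 y).2) x
  have h8 : quadForm (1 : Matrix (Fin n) (Fin n) ℝ)⁻¹ x = ‖x‖ ^ 2 := by
    rw [inv_one, quadForm_def, map_one]; exact real_inner_self_eq_norm_sq x
  rw [h8] at h7
  rw [quadForm_sub]
  have h9 : ε / C / t * ‖x‖ ^ 2 ≤ ε * quadForm (Qt Q B t)⁻¹ x := by
    calc ε / C / t * ‖x‖ ^ 2 ≤ ε / C / t * (C * t * quadForm (Qt Q B t)⁻¹ x) := by gcongr
      _ = _ := by field_simp
  linarith

end Covariance

/-! ### The flow D_t, the growth of R, and the Gaussian bound for the kernel. -/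

section Kernel

variable {n : ℕ}

/-- The generator of the one-parameter group `D_t`. -/
noncomputable def flowGen (Q B : Matrix (Fin n) (Fin n) ℝ) : E n →L[ℝ] E n :=
  toEuclideanCLM (𝕜 := ℝ) (-(Qinf Q B * Bᵀ * (Qinf Q B)⁻¹))

/-- D_t is a conjugate of e^{-tB*}, hence a one-parameter group; the later argument can therefore be
stated for abstract linear flows. -/
theorem toEuclideanCLM_D {Q B : Matrix (Fin n) (Fin n) ℝ} (h : IsUnit (Qinf Q B)) (t : ℝ) :
    toEuclideanCLM (𝕜 := ℝ) (D Q B t) = NormedSpace.exp (t • flowGen Q B) := by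
  have h1 : D Q B t = NormedSpace.exp (t • -(Qinf Q B * Bᵀ * (Qinf Q B)⁻¹)) := by
    rw [D, ← Matrix.exp_conj _ _ h]
    congr 1
    simp only [neg_smul, smul_neg, Matrix.mul_neg, Matrix.neg_mul, Matrix.mul_smul,
      Matrix.smul_mul]
  rw [h1, flowGen, ← map_smul]
  let _ : NormedAlgebra ℚ (Matrix (Fin n) (Fin n) ℝ) := NormedAlgebra.restrictScalars ℚ ℝ _
  refine NormedSpace.map_exp (toEuclideanCLM (𝕜 := ℝ) (n := Fin n)) ?_ _
  exact LinearMap.continuous_of_finiteDimensional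
    (toEuclideanCLM (𝕜 := ℝ) (n := Fin n)).toAlgEquiv.toLinearMap

theorem exists_R_bounds {Q B : Matrix (Fin n) (Fin n) ℝ} (hP : (Qinf Q B).PosDef) :
    ∃ c C : ℝ, 0 < c ∧ 0 < C ∧ ∀ x : E n, c * ‖x‖ ^ 2 ≤ R Q B x ∧ R Q B x ≤ C * ‖x‖ ^ 2 := by
  obtain ⟨c, hc, h⟩ := exists_le_quadForm hP.inv
  refine ⟨c / 2, (‖(Qinf Q B)⁻¹‖ + 1) / 2, by positivity, by positivity, fun x => ?_⟩
  have h1 := h x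
  have h2 := quadForm_le (Qinf Q B)⁻¹ x
  rw [R]
  constructor
  · linarith
  · nlinarith [sq_nonneg ‖x‖]

theorem continuous_R (Q B : Matrix (Fin n) (Fin n) ℝ) : Continuous (R Q B) :=
  (continuous_quadForm _).const_mul _

/-- `R` grows along the flow `D_s`. -/
theorem exists_le_R_D {Q B : Matrix (Fin n) (Fin n) ℝ} (hQ : Q.PosDef)
    (hB : EigenvaluesNegRe B) :
    ∃ c : ℝ, 0 < c ∧ ∀ s, 0 ≤ s → s ≤ 1 → ∀ x : E n,
      (1 + c * s) * R Q B x ≤ R Q B (toEuclideanCLM (𝕜 := ℝ) (D Q B s) x) := by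
  have hP := posDef_Qinf hQ hB
  have hdet := (isUnit_iff_isUnit_det _).1 hP.isUnit
  obtain ⟨q, _, hq, _, hQt⟩ := exists_quadForm_Qt_bounds hQ B
  obtain ⟨a, ha, hal⟩ := exists_le_norm_adjFlow B
  refine ⟨q * a ^ 2 / (‖Qinf Q B‖ + 1), by positivity, fun s hs hs1 x => ?_⟩
  set P := Qinf Q B
  set y := toEuclideanCLM (𝕜 := ℝ) P⁻¹ x
  have hx : toEuclideanCLM (𝕜 := ℝ) P y = x := by
    rw [← toEuclideanCLM_mul_apply, mul_nonsing_inv _ hdet]; simp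
  have hinv : ∀ z, quadForm P⁻¹ (toEuclideanCLM (𝕜 := ℝ) P z) = quadForm P z := by
    intro z
    rw [quadForm_def, ← toEuclideanCLM_mul_apply, nonsing_inv_mul _ hdet, quadForm_def,
      real_inner_comm]
    simp
  have hRx : R Q B x = 1 / 2 * quadForm P y := by
    rw [R, ← hinv y, hx]
  have hDx : toEuclideanCLM (𝕜 := ℝ) (D Q B s) x = toEuclideanCLM (𝕜 := ℝ) P (adjFlow B (-s) y) := by
    rw [D, toEuclideanCLM_mul_apply, toEuclideanCLM_mul_apply]; rfl
  have hRD : R Q B (toEuclideanCLM (𝕜 := ℝ) (D Q B s) x) =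
      1 / 2 * quadForm P (adjFlow B (-s) y) := by
    rw [R, hDx, hinv]
  -- Splitting Q_∞ at time s, evaluated at e^{-sB*}y, returns the form of Q_∞ at y plus that of Q_s
  -- at e^{-sB*}y. The latter is the gain, of order s|y|².
  rw [hRD, hRx, quadForm_Qinf_eq_add Q hB hs (adjFlow B (-s) y), ← adjFlow_add, add_neg_cancel, adjFlow_zero]
  have h1 := (hQt s hs hs1 (adjFlow B (-s) y)).1
  have h2 : (a * ‖y‖) ^ 2 ≤ ‖adjFlow B (-s) y‖ ^ 2 := by
    gcongr
    exact hal (-s) ⟨by linarith, by linarith⟩ y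
  have h3 : quadForm P y ≤ (‖P‖ + 1) * ‖y‖ ^ 2 :=
    (quadForm_le P y).trans (by gcongr; linarith)
  have h4 : q * a ^ 2 / (‖P‖ + 1) * s * quadForm P y ≤ q * s * ‖adjFlow B (-s) y‖ ^ 2 := by
    calc _ ≤ q * a ^ 2 / (‖P‖ + 1) * s * ((‖P‖ + 1) * ‖y‖ ^ 2) := by gcongr
      _ = q * s * (a * ‖y‖) ^ 2 := by field_simp
      _ ≤ _ := by gcongr
  linarith

/-- Gaussian upper bound for the Mehler kernel for small times. -/
theorem exists_mehler_le {Q B : Matrix (Fin n) (Fin n) ℝ} (hQ : Q.PosDef)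
    (hB : EigenvaluesNegRe B) :
    ∃ C c : ℝ, 0 < C ∧ 0 < c ∧ ∀ t, 0 < t → t ≤ 1 → ∀ x u : E n,
      mehler Q B t x u ≤ C * Real.exp (R Q B x) *
        ((√t ^ n)⁻¹ * Real.exp (-c * (‖u - toEuclideanCLM (𝕜 := ℝ) (D Q B t) x‖ / √t) ^ 2)) := by
  have hP := posDef_Qinf hQ hB
  obtain ⟨q, _, hq, _, hQt⟩ := exists_quadForm_Qt_bounds hQ B
  obtain ⟨c, hc, hcl⟩ := exists_le_quadForm_inv_sub_inv hQ hB
  have hd : 0 < (Qinf Q B).det := hP.det_pos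
  refine ⟨√((Qinf Q B).det / q ^ n), c / 2, by positivity, by positivity,
    fun t ht ht1 x u => ?_⟩
  have hPt := posDef_Qt hQ B ht ht1
  have hst : 0 < √t := Real.sqrt_pos.2 ht
  have hdet : (q * t) ^ n ≤ (Qt Q B t).det :=
    pow_le_det hPt (by positivity) fun x => (hQt t ht.le ht1 x).1
  have h1 : ((Qinf Q B).det / (Qt Q B t).det) ^ ((1 : ℝ) / 2) ≤
      √((Qinf Q B).det / q ^ n) * (√t ^ n)⁻¹ := by
    rw [← Real.sqrt_eq_rpow]
    have : √((Qinf Q B).det / q ^ n) * (√t ^ n)⁻¹ = √((Qinf Q B).det / (q * t) ^ n) := by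
      rw [mul_pow, ← div_div, Real.sqrt_div (x := (Qinf Q B).det / q ^ n) (by positivity), div_eq_mul_inv]
      congr 2
      rw [eq_comm, Real.sqrt_eq_iff_mul_self_eq (by positivity) (by positivity), ← mul_pow,
        Real.mul_self_sqrt ht.le]
    rw [this]
    gcongr
  have h2 : -(1 / 2) * quadForm ((Qt Q B t)⁻¹ - (Qinf Q B)⁻¹)
      (u - toEuclideanLin (D Q B t) x) ≤
      -(c / 2) * (‖u - toEuclideanCLM (𝕜 := ℝ) (D Q B t) x‖ / √t) ^ 2 := by
    have := hcl t ht ht1 (u - toEuclideanLin (D Q B t) x)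
    have e : c / t * ‖u - toEuclideanLin (D Q B t) x‖ ^ 2 =
      c * (‖u - toEuclideanCLM (𝕜 := ℝ) (D Q B t) x‖ / √t) ^ 2 := by
      rw [div_pow, Real.sq_sqrt ht.le]
      change c / t * ‖u - toEuclideanCLM (𝕜 := ℝ) (D Q B t) x‖ ^ 2 = _
      ring
    linarith
  rw [mehler]
  calc _ ≤ (√((Qinf Q B).det / q ^ n) * (√t ^ n)⁻¹) * Real.exp (R Q B x) *
        Real.exp (-(c / 2) * (‖u - toEuclideanCLM (𝕜 := ℝ) (D Q B t) x‖ / √t) ^ 2) := by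
        gcongr
    _ = _ := by ring

theorem mehler_nonneg (Q B : Matrix (Fin n) (Fin n) ℝ) {t : ℝ}
    (h : 0 ≤ (Qinf Q B).det / (Qt Q B t).det) (x u : E n) : 0 ≤ mehler Q B t x u := by
  rw [mehler]
  positivity

theorem continuous_mehler (Q B : Matrix (Fin n) (Fin n) ℝ) (t : ℝ) :
    Continuous fun p : E n × E n => mehler Q B t p.1 p.2 := by
  have h1 : Continuous fun p : E n × E n => p.2 - toEuclideanLin (D Q B t) p.1 :=
    continuous_snd.sub ((toEuclideanCLM (𝕜 := ℝ) (D Q B t)).continuous.comp continuous_fst)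
  have h2 := (continuous_quadForm ((Qt Q B t)⁻¹ - (Qinf Q B)⁻¹)).comp h1
  have h3 := (continuous_R Q B).comp (continuous_fst (X := E n) (Y := E n))
  exact (continuous_const.mul (Real.continuous_exp.comp h3)).mul
    (Real.continuous_exp.comp (continuous_const.mul h2))

end Kernel

/-! ### The covering, the partition of unity and η. -/

namespace Localization

variable {n : ℕ} (L : Localization n)

theorem mem_scaledBall {k : ℝ} {c x : E n} :
    x ∈ scaledBall k c ↔ ‖x - c‖ < k / (1 + ‖c‖) := by
  rw [scaledBall, mem_ball, dist_eq_norm]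

theorem le_norm_sub_center {i j : ℕ} (h : i ≠ j) :
    1 / (1 + ‖L.center i‖) ≤ ‖L.center i - L.center j‖ := by
  by_contra hcon
  push Not at hcon
  refine Set.disjoint_left.1 (L.disjoint h) (?_ : L.center j ∈ _) ?_
  · rw [mem_scaledBall, norm_sub_rev]; exact hcon
  · rw [mem_scaledBall, sub_self, norm_zero]; positivity

/-- Centres of scaled balls containing x stay in a bounded set, where distinct centres have a
uniform positive separation; infinitely many would contradict compactness. -/
theorem finite_mem_scaledBall (k : ℝ) (x : E n) :
    {j | x ∈ scaledBall k (L.center j)}.Finite := by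
  by_contra hinf
  have hinf : {j | x ∈ scaledBall k (L.center j)}.Infinite := hinf
  have hmem : ∀ j ∈ {j | x ∈ scaledBall k (L.center j)},
      L.center j ∈ closedBall x |k| := by
    intro j hj
    have h1 := mem_scaledBall.1 hj
    have h2 : k / (1 + ‖L.center j‖) ≤ |k| := by
      rw [div_le_iff₀ (by positivity)]
      nlinarith [le_abs_self k, abs_nonneg k, norm_nonneg (L.center j)]
    rw [mem_closedBall, dist_comm, dist_eq_norm]
    linarith
  obtain ⟨e, he⟩ : ∃ e : ℕ → ℕ, Function.Injective e ∧ ∀ m, x ∈ scaledBall k (L.center (e m)) :=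
    ⟨_, (Nat.nth_injective hinf), fun m => Nat.nth_mem_of_infinite hinf m⟩
  obtain ⟨a, -, φ, hφ, hlim⟩ := (isCompact_closedBall x |k|).tendsto_subseq
    (fun m => hmem (e m) (he.2 m))
  set ε : ℝ := 1 / (1 + (‖x‖ + |k|))
  have hε : 0 < ε := by positivity
  obtain ⟨N, hN⟩ := Metric.cauchySeq_iff'.1 hlim.cauchySeq ε hε
  have h1 := hN (N + 1) (Nat.le_succ N)
  have hne : e (φ (N + 1)) ≠ e (φ N) := fun h => by
    have := hφ.injective (he.1 h); omega
  have h2 := L.le_norm_sub_center hne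
  have h3 : ‖L.center (e (φ (N + 1)))‖ ≤ ‖x‖ + |k| := by
    have := hmem _ (he.2 (φ (N + 1)))
    rw [mem_closedBall, dist_eq_norm] at this
    have h4 := norm_add_le x (L.center (e (φ (N + 1))) - x)
    rw [add_sub_cancel] at h4
    linarith
  have h4 : ε ≤ 1 / (1 + ‖L.center (e (φ (N + 1)))‖) := by
    apply one_div_le_one_div_of_le (by positivity); linarith
  simp only [Function.comp, dist_eq_norm] at h1
  linarith

theorem finite_support_rho (u : E n) : (Function.support fun j => L.rho j u).Finite :=
  (L.finite_mem_scaledBall 4 u).subset fun j hj => L.rho_support j hj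

-- The ball about `center 0` covers |y| < 3. For other y, maximality gives a ball meeting that of y,
-- and the radius at y is at most twice the radius at the centre found, so 2 + 1 = 3 suffices.
theorem exists_mem_scaledBall_three (y : E n) : ∃ j, y ∈ scaledBall 3 (L.center j) := by
  by_cases hy : ‖y‖ < 3
  · refine ⟨0, ?_⟩
    rw [mem_scaledBall, L.center_zero]
    simpa using hy
  push Not at hy
  obtain ⟨j, hj⟩ := L.maximal y
  obtain ⟨z, hz1, hz2⟩ := Set.not_disjoint_iff.1 hj
  refine ⟨j, ?_⟩
  rw [mem_scaledBall] at hz1 hz2 ⊢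
  set c := L.center j
  have h1 : ‖y - c‖ ≤ ‖z - y‖ + ‖z - c‖ := by
    have := norm_sub_le (z - c) (z - y)
    rw [sub_sub_sub_cancel_left] at this
    linarith
  have h2 : 1 / (1 + ‖c‖) ≤ 1 := by
    rw [div_le_one (by positivity)]; linarith [norm_nonneg c]
  have h3 : 1 / (1 + ‖y‖) ≤ 1 := by
    rw [div_le_one (by positivity)]; linarith
  have h4 : ‖c‖ ≤ ‖y‖ + 2 := by
    have := norm_sub_norm_le c y
    rw [norm_sub_rev] at this
    linarith
  have h5 : 1 / (1 + ‖y‖) ≤ 2 / (1 + ‖c‖) := by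
    rw [div_le_div_iff₀ (by positivity) (by positivity)]; linarith
  have h6 : 3 / (1 + ‖c‖) = 2 / (1 + ‖c‖) + 1 / (1 + ‖c‖) := by ring
  linarith

theorem tsum_rho_pos (u : E n) : 0 < ∑' i, L.rho i u := by
  obtain ⟨j, hj⟩ := L.exists_mem_scaledBall_three u
  have hs : Summable fun i => L.rho i u := summable_of_hasFiniteSupport (L.finite_support_rho u)
  exact hs.tsum_pos (fun i => L.rho_nonneg i u) j (by rw [L.rho_eq_one j u hj]; exact one_pos)

theorem r_nonneg (j : ℕ) (u : E n) : 0 ≤ L.r j u :=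
  div_nonneg (L.rho_nonneg j u) (tsum_nonneg fun i => L.rho_nonneg i u)

theorem tsum_r (u : E n) : ∑' j, L.r j u = 1 := by
  simp only [r]
  rw [tsum_div_const, div_self (L.tsum_rho_pos u).ne']

theorem eta_nonneg (x u : E n) : 0 ≤ L.eta x u :=
  tsum_nonneg fun j => mul_nonneg (L.rTilde_mem j x).1 (L.r_nonneg j u)

/-- `η = 1` in a neighbourhood of the diagonal. -/
theorem eta_eq_one {x u : E n} (h : ‖x - u‖ < 1 / 10 / (1 + ‖x‖)) : L.eta x u = 1 := by
  rw [← L.tsum_r u]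
  refine tsum_congr fun j => ?_
  by_cases hj : L.rho j u = 0
  · simp [r, hj]
  have hu : u ∈ scaledBall 4 (L.center j) := L.rho_support j hj
  -- If ρ_j(u) ≠ 0 then u lies in 4B_j. Since |c| ≤ |x| + 5, the factor 1/10 makes |x - u| less than
  -- one radius of B_j, so x lies in 5B_j, where the outer cut-off is 1.
  rw [L.rTilde_eq_one j x ?_, one_mul]
  rw [mem_scaledBall] at hu ⊢
  set c := L.center j
  have h1 : 1 / 10 / (1 + ‖x‖) ≤ 1 / 10 := by
    rw [div_le_iff₀ (by positivity)]; nlinarith [norm_nonneg x]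
  have h2 : 4 / (1 + ‖c‖) ≤ 4 := by
    rw [div_le_iff₀ (by positivity)]; nlinarith [norm_nonneg c]
  have h3 : ‖x - c‖ ≤ ‖x - u‖ + ‖u - c‖ := norm_sub_le_norm_sub_add_norm_sub x u c
  have h4 : ‖c‖ ≤ ‖x‖ + 5 := by
    have := norm_sub_norm_le c x
    rw [norm_sub_rev] at this
    linarith
  have h5 : 1 / 10 / (1 + ‖x‖) ≤ 1 / (1 + ‖c‖) := by
    rw [div_le_div_iff₀ (by positivity) (by positivity)]; nlinarith [norm_nonneg x]
  have h6 : 5 / (1 + ‖c‖) = 4 / (1 + ‖c‖) + 1 / (1 + ‖c‖) := by ring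
  linarith

/-- No summability is needed: a divergent real sum is 0 by default, and `toReal` also sends ∞ to 0.
-/
theorem measurable_tsum_of_nonneg {α : Type*} [MeasurableSpace α] {g : ℕ → α → ℝ}
    (hm : ∀ j, Measurable (g j)) (h0 : ∀ j x, 0 ≤ g j x) : Measurable fun x => ∑' j, g j x := by
  have : (fun x => ∑' j, g j x) = fun x => (∑' j, ENNReal.ofReal (g j x)).toReal := by
    ext x
    rw [ENNReal.tsum_toReal_eq fun _ => ENNReal.ofReal_ne_top]
    simp_rw [ENNReal.toReal_ofReal (h0 _ x)]
  rw [this]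
  exact (Measurable.tsum fun j => (hm j).ennreal_ofReal).ennreal_toReal

theorem measurable_eta : Measurable fun p : E n × E n => L.eta p.1 p.2 := by
  refine measurable_tsum_of_nonneg (fun j => ?_) fun j p =>
    mul_nonneg (L.rTilde_mem j p.1).1 (L.r_nonneg j p.2)
  have h1 : Measurable (L.rTilde j) := (L.rTilde_smooth j).continuous.measurable
  have h2 : ∀ j, Measurable (L.rho j) := fun j => (L.rho_smooth j).continuous.measurable
  have h3 : Measurable (L.r j) :=
    (h2 j).div (measurable_tsum_of_nonneg h2 fun j x => L.rho_nonneg j x)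
  exact (h1.comp measurable_fst).mul (h3.comp measurable_snd)

end Localization

/-! ### Measurability of the maximal operator. -/

variable {n : ℕ}

/-- The supremum is over uncountably many t, so measurability comes from lower semicontinuity of a
supremum of continuous functions. The factor 1 - η does not depend on t and is pulled out first. -/
theorem measurable_iSup_mehler (Q B : Matrix (Fin n) (Fin n) ℝ) (hP : 0 ≤ (Qinf Q B).det)
    (hPt : ∀ t ∈ Set.Ioc (0 : ℝ) 1, 0 ≤ (Qt Q B t).det) (L : Localization n) :
    Measurable fun p : E n × E n => ⨆ t ∈ Set.Ioc (0 : ℝ) 1,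
      ENNReal.ofReal (mehler Q B t p.1 p.2 * (1 - L.eta p.1 p.2)) := by
  have h1 : (fun p : E n × E n => ⨆ t ∈ Set.Ioc (0 : ℝ) 1,
      ENNReal.ofReal (mehler Q B t p.1 p.2 * (1 - L.eta p.1 p.2))) = fun p =>
      (⨆ t ∈ Set.Ioc (0 : ℝ) 1, ENNReal.ofReal (mehler Q B t p.1 p.2)) *
        ENNReal.ofReal (1 - L.eta p.1 p.2) := by
    ext p
    simp_rw [ENNReal.iSup_mul]
    refine iSup_congr fun t => iSup_congr fun ht => ENNReal.ofReal_mul ?_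
    exact mehler_nonneg Q B (div_nonneg hP (hPt t ht)) _ _
  rw [h1]
  refine Measurable.mul ?_ ((measurable_const.sub L.measurable_eta).ennreal_ofReal)
  refine LowerSemicontinuous.measurable (lowerSemicontinuous_biSup fun t _ => ?_)
  exact (ENNReal.continuous_ofReal.comp (continuous_mehler Q B t)).lowerSemicontinuous

instance sFinite_gammaInf (Q B : Matrix (Fin n) (Fin n) ℝ) : SFinite (gammaInf Q B) := by
  unfold gammaInf; infer_instance

theorem S0glob_congr_ae (Q B : Matrix (Fin n) (Fin n) ℝ) (L : Localization n) {f g : E n → ℂ}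
    (h : f =ᵐ[gammaInf Q B] g) : S0glob Q B L f = S0glob Q B L g := by
  ext x
  refine lintegral_congr_ae ?_
  filter_upwards [h] with u hu
  rw [hu]

theorem measurable_S0glob (Q B : Matrix (Fin n) (Fin n) ℝ) (hP : 0 ≤ (Qinf Q B).det)
    (hPt : ∀ t ∈ Set.Ioc (0 : ℝ) 1, 0 ≤ (Qt Q B t).det) (L : Localization n) {f : E n → ℂ}
    (hf : Measurable f) : Measurable (S0glob Q B L f) := by
  refine Measurable.lintegral_prod_right ?_
  exact (measurable_iSup_mehler Q B hP hPt L).mul (hf.enorm.comp measurable_snd)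

/-! ### One-parameter linear groups. -/

section LinearFlow

variable {V : Type*} [NormedAddCommGroup V] [NormedSpace ℝ V]

/-- The one-parameter group generated by `G`. -/
noncomputable def linFlow (G : V →L[ℝ] V) (s : ℝ) : V →L[ℝ] V := NormedSpace.exp (s • G)

theorem linFlow_zero (G : V →L[ℝ] V) (x : V) : linFlow G 0 x = x := by
  simp [linFlow]

variable [FiniteDimensional ℝ V]

theorem hasDerivAt_linFlow (G : V →L[ℝ] V) (s : ℝ) :
    HasDerivAt (linFlow G) (linFlow G s * G) s := by
  have := FiniteDimensional.complete ℝ V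
  exact hasDerivAt_exp_smul_const (𝕂 := ℝ) G s

theorem continuous_linFlow (G : V →L[ℝ] V) : Continuous (linFlow G) :=
  continuous_iff_continuousAt.2 fun s => (hasDerivAt_linFlow G s).continuousAt

theorem linFlow_add (G : V →L[ℝ] V) (s t : ℝ) (x : V) :
    linFlow G (s + t) x = linFlow G s (linFlow G t x) := by
  have := FiniteDimensional.complete ℝ V
  let _ : NormedAlgebra ℚ (V →L[ℝ] V) := NormedAlgebra.restrictScalars ℚ ℝ _
  rw [linFlow, add_smul, NormedSpace.exp_add_of_commute]
  · rfl
  · exact ((Commute.refl G).smul_left _).smul_right _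

theorem continuous_linFlow_apply (G : V →L[ℝ] V) :
    Continuous fun p : ℝ × V => linFlow G p.1 p.2 :=
  ((continuous_linFlow G).comp continuous_fst).clm_apply continuous_snd

theorem exists_norm_linFlow_sub_le (G : V →L[ℝ] V) (S : ℝ) :
    ∃ C : ℝ, 0 < C ∧ ∀ s ∈ Set.Icc 0 S, ∀ t ∈ Set.Icc 0 S, ∀ x : V,
      ‖linFlow G s x - linFlow G t x‖ ≤ C * |s - t| * ‖x‖ := by
  obtain ⟨C, hC⟩ := (isCompact_Icc (a := (0 : ℝ)) (b := S)).exists_bound_of_continuousOn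
    (f := fun s => linFlow G s * G) ((continuous_linFlow G).mul continuous_const).continuousOn
  refine ⟨|C| + 1, by positivity, fun s hs t ht x => ?_⟩
  have h := (convex_Icc (0 : ℝ) S).norm_image_sub_le_of_norm_hasDerivWithin_le
    (fun r _ => (hasDerivAt_linFlow G r).hasDerivWithinAt) hC ht hs
  have h2 : ‖linFlow G s x - linFlow G t x‖ ≤ ‖linFlow G s - linFlow G t‖ * ‖x‖ := by
    rw [← _root_.sub_apply]; exact ContinuousLinearMap.le_opNorm _ _
  refine h2.trans ?_
  gcongr
  refine h.trans ?_
  rw [Real.norm_eq_abs]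
  gcongr
  linarith [le_abs_self C]

variable [MeasurableSpace V] [BorelSpace V] (μ : Measure V) [μ.IsAddHaarMeasure]

/-- Change of variables: the Jacobian of the inverse map is the determinant at time -s, continuous
in s and so bounded on a compact interval. -/
theorem exists_lintegral_linFlow_le (G : V →L[ℝ] V) (S : ℝ) :
    ∃ C : ℝ, 0 < C ∧ ∀ s ∈ Set.Icc (-S) S, ∀ g : V → ENNReal, Measurable g →
      ∫⁻ y, g (linFlow G s y) ∂μ ≤ ENNReal.ofReal C * ∫⁻ z, g z ∂μ := by
  obtain ⟨C, hC⟩ := (isCompact_Icc (a := -S) (b := S)).exists_bound_of_continuousOn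
    (f := fun s => (linFlow G s).det)
    (ContinuousLinearMap.continuous_det.comp (continuous_linFlow G)).continuousOn
  refine ⟨|C| + 1, by positivity, fun s hs g hg => ?_⟩
  have hcomp : (linFlow G s : V →ₗ[ℝ] V) ∘ₗ (linFlow G (-s) : V →ₗ[ℝ] V) = LinearMap.id := by
    ext x
    simp [← linFlow_add, linFlow_zero]
  have hdet : LinearMap.det (linFlow G s : V →ₗ[ℝ] V) *
      LinearMap.det (linFlow G (-s) : V →ₗ[ℝ] V) = 1 := by
    rw [← LinearMap.det_comp, hcomp, LinearMap.det_id]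
  have hne : LinearMap.det (linFlow G s : V →ₗ[ℝ] V) ≠ 0 := left_ne_zero_of_mul_eq_one hdet
  have hmap := Measure.map_linearMap_addHaar_eq_smul_addHaar μ hne
  have hinv : (LinearMap.det (linFlow G s : V →ₗ[ℝ] V))⁻¹ =
      LinearMap.det (linFlow G (-s) : V →ₗ[ℝ] V) := (eq_inv_of_mul_eq_one_right hdet).symm
  have h1 : ∫⁻ y, g (linFlow G s y) ∂μ =
      ∫⁻ z, g z ∂(μ.map (linFlow G s : V →ₗ[ℝ] V)) :=
    (lintegral_map hg (linFlow G s).continuous.measurable).symm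
  rw [h1, hmap, lintegral_smul_measure, smul_eq_mul, hinv]
  gcongr
  have := hC (-s) ⟨by linarith [hs.2], by linarith [hs.1]⟩
  rw [Real.norm_eq_abs] at this
  exact this.trans (by linarith [le_abs_self C])

end LinearFlow

/-! ### From the supremum over t to an average along orbits. -/

section PointwiseBound

variable {V : Type*} [NormedAddCommGroup V] [NormedSpace ℝ V] [FiniteDimensional ℝ V]

theorem exists_one_add_pow_mul_exp_le (d : ℕ) {c : ℝ} (hc : 0 < c) :
    ∃ K : ℝ, 0 < K ∧ ∀ r : ℝ, 0 ≤ r → (1 + r) ^ (d + 1) * Real.exp (-c * r ^ 2) ≤ K := by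
  set c' : ℝ := c / (d + 1)
  have hc' : 0 < c' := by positivity
  refine ⟨(2 + 1 / c') ^ (d + 1), by positivity, fun r hr => ?_⟩
  have h1 : 1 + r ≤ (2 + 1 / c') * Real.exp (c' * r ^ 2) := by
    have h2 := Real.add_one_le_exp (c' * r ^ 2)
    calc 1 + r ≤ (2 + 1 / c') * (c' * r ^ 2 + 1) := by
          have : (2 + 1 / c') * (c' * r ^ 2 + 1) = 2 * c' * r ^ 2 + 2 + r ^ 2 + 1 / c' := by
            field_simp; ring
          rw [this]
          have h3 : 0 < 1 / c' := by positivity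
          have h4 : 0 ≤ c' * r ^ 2 := by positivity
          nlinarith [sq_nonneg (r - 1)]
      _ ≤ _ := by gcongr
  have h2 : Real.exp (c' * r ^ 2) ^ (d + 1) = Real.exp (c * r ^ 2) := by
    rw [← Real.exp_nat_mul]
    congr 1
    simp only [c']; push_cast; field_simp
  calc (1 + r) ^ (d + 1) * Real.exp (-c * r ^ 2)
      ≤ ((2 + 1 / c') * Real.exp (c' * r ^ 2)) ^ (d + 1) * Real.exp (-c * r ^ 2) := by gcongr
    _ = (2 + 1 / c') ^ (d + 1) * (Real.exp (c * r ^ 2) * Real.exp (-c * r ^ 2)) := by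
        rw [mul_pow, h2]; ring
    _ = _ := by rw [← Real.exp_add]; simp

/-- Away from the diagonal, the Gaussian kernels `t^{-d/2} exp(-c |u - T_t x|² / t)` along a linear
flow are bounded uniformly in `0 < t ≤ 1`, both pointwise and by an average along the orbit. -/
theorem exists_gaussian_flow_le (G : V →L[ℝ] V) (d : ℕ) {c κ : ℝ} (hc : 0 < c) (hκ : 0 < κ) :
    ∃ C : ℝ, 0 < C ∧ ∀ (t : ℝ), 0 < t → t ≤ 1 → ∀ (x u : V) (Λ : ℝ), 1 + ‖x‖ ≤ Λ →
      κ / (1 + ‖x‖) ≤ ‖x - u‖ →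
      (√t ^ d)⁻¹ * Real.exp (-c * (‖u - linFlow G t x‖ / √t) ^ 2) ≤ C * Λ ^ d ∧
      ENNReal.ofReal ((√t ^ d)⁻¹ * Real.exp (-c * (‖u - linFlow G t x‖ / √t) ^ 2)) ≤
        ENNReal.ofReal (C * Λ) * ∫⁻ s in Set.Icc (0 : ℝ) 2,
          ENNReal.ofReal (((Λ⁻¹ + ‖u - linFlow G s x‖) ^ (d + 1))⁻¹) := by
  obtain ⟨K, hK, hKb⟩ := exists_one_add_pow_mul_exp_le d hc
  obtain ⟨CT, hCT, hT⟩ := exists_norm_linFlow_sub_le G 2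
  -- Chosen so that, if √t < κ₁/Λ, the displacement of x up to time t is at most κ₁/Λ, half or less
  -- of the distance κ/Λ to u.
  set κ₁ : ℝ := min (κ / 2) (1 / CT) with hκ₁
  have hκ₁0 : 0 < κ₁ := by positivity
  have hκ₁a : κ₁ ≤ κ / 2 := min_le_left _ _
  have hκ₁b : CT * κ₁ ≤ 1 := by
    have : κ₁ ≤ 1 / CT := min_le_right _ _
    rwa [le_div_iff₀ hCT, mul_comm] at this
  set M : ℝ := 1 / κ₁ + 1 + CT with hM
  have hM0 : 0 < M := by positivity
  refine ⟨K * (1 / κ₁) ^ d + K * M ^ (d + 1), by positivity, fun t ht ht1 x u Λ hΛ hxu => ?_⟩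
  have hx0 := norm_nonneg x
  have hΛ1 : 1 ≤ Λ := by linarith
  have hΛ0 : 0 < Λ := by linarith
  set σ := √t with hσ
  have hσ0 : 0 < σ := Real.sqrt_pos.2 ht
  have hσ1 : σ ≤ 1 := Real.sqrt_le_one.2 ht1
  have hσt : σ ^ 2 = t := Real.sq_sqrt ht.le
  set a := ‖u - linFlow G t x‖ with ha
  have ha0 : 0 ≤ a := norm_nonneg _
  set b := a + σ with hb
  have hb0 : 0 < b := by positivity
  set r := a / σ with hr
  have hr0 : 0 ≤ r := by positivity
  have hbr : b = σ * (1 + r) := by rw [hb, hr]; field_simp; ring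
  set g := (σ ^ d)⁻¹ * Real.exp (-c * r ^ 2) with hg
  have hg0 : 0 < g := by positivity
  -- With b = |u - T_t x| + √t, this bound and b ≥ κ₁/Λ are all that both estimates require of the
  -- Gaussian and the separation.
  have hgK : g * b ^ (d + 1) ≤ K * σ := by
    calc g * b ^ (d + 1) = σ * ((1 + r) ^ (d + 1) * Real.exp (-c * r ^ 2)) := by
          rw [hg, hbr, mul_pow]; field_simp; ring
      _ ≤ σ * K := by gcongr; exact hKb r hr0
      _ = _ := mul_comm _ _
  have hσb : σ ≤ b := by linarith
  have hgd : g * b ^ d ≤ K := by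
    have : g * b ^ d * b ≤ K * b := by
      calc g * b ^ d * b = g * b ^ (d + 1) := by ring
        _ ≤ K * σ := hgK
        _ ≤ K * b := by gcongr
    exact le_of_mul_le_mul_right this hb0
  have hbΛ : κ₁ / Λ ≤ b := by
    rcases le_or_gt (κ₁ / Λ) σ with h | h
    · linarith
    have h1 : ‖x - linFlow G t x‖ ≤ CT * t * ‖x‖ := by
      have := hT 0 (by norm_num) t ⟨ht.le, by linarith⟩ x
      rw [linFlow_zero, zero_sub, abs_neg, abs_of_pos ht] at this
      exact this
    have h2 : ‖x - u‖ ≤ a + ‖x - linFlow G t x‖ := by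
      rw [add_comm, ha, norm_sub_rev u]
      exact norm_sub_le_norm_sub_add_norm_sub _ _ _
    have h3 : κ / Λ ≤ κ / (1 + ‖x‖) := by gcongr
    have h4 : CT * t * ‖x‖ ≤ κ₁ / Λ := by
      calc CT * t * ‖x‖ ≤ CT * (κ₁ / Λ) ^ 2 * Λ := by
            rw [← hσt]; gcongr; linarith
        _ = (CT * κ₁) * (κ₁ / Λ) := by field_simp
        _ ≤ 1 * (κ₁ / Λ) := by gcongr
        _ = _ := one_mul _
    have h5 : κ₁ / Λ + κ₁ / Λ ≤ κ / Λ := by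
      rw [← add_div]; gcongr; linarith
    linarith
  have hΛb : Λ⁻¹ ≤ b / κ₁ := by
    rw [le_div_iff₀ hκ₁0, inv_mul_eq_div]; exact hbΛ
  constructor
  · have h1 : 1 ≤ b * (Λ / κ₁) := by
      rw [div_le_iff₀ hΛ0] at hbΛ
      rw [← mul_div_assoc, le_div_iff₀ hκ₁0]; linarith
    calc g ≤ g * (b * (Λ / κ₁)) ^ d := le_mul_of_one_le_right hg0.le (one_le_pow₀ h1)
      _ = g * b ^ d * (1 / κ₁) ^ d * Λ ^ d := by
          rw [mul_pow, div_pow, div_pow]; field_simp; ring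
      _ ≤ K * (1 / κ₁) ^ d * Λ ^ d := by gcongr
      _ ≤ _ := by
          gcongr; exact le_add_of_nonneg_right (by positivity)
  -- For a time h after t the orbit moves by O(b), so the averaged kernel stays at least
  -- (Mb)^{-(d+1)}. Moreover Λh ≥ √t, which turns the factor √t in `hgK` into Λ times the length of
  -- the interval. As t, h ≤ 1, times up to 2 suffice.
  · set h := min 1 (b / Λ) with hh
    have hh0 : 0 < h := by positivity
    have hh1 : h ≤ 1 := min_le_left _ _
    have hhb : h * Λ ≤ b := by rw [← le_div_iff₀ hΛ0]; exact min_le_right _ _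
    have hsub : Set.Icc t (t + h) ⊆ Set.Icc (0 : ℝ) 2 :=
      Set.Icc_subset_Icc ht.le (by linarith)
    have hlow : ∀ s ∈ Set.Icc t (t + h), ENNReal.ofReal (((M * b) ^ (d + 1))⁻¹) ≤
        ENNReal.ofReal (((Λ⁻¹ + ‖u - linFlow G s x‖) ^ (d + 1))⁻¹) := by
      intro s hs
      have h1 := hT s (hsub hs) t ⟨ht.le, by linarith⟩ x
      rw [abs_of_nonneg (by linarith [hs.1])] at h1
      have h2 : CT * (s - t) * ‖x‖ ≤ CT * b := by
        calc CT * (s - t) * ‖x‖ ≤ CT * h * Λ := by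
              gcongr
              · linarith [hs.2]
              · linarith
          _ = CT * (h * Λ) := by ring
          _ ≤ _ := by gcongr
      have h3 : ‖u - linFlow G s x‖ ≤ a + CT * b := by
        have := norm_sub_le_norm_sub_add_norm_sub u (linFlow G t x) (linFlow G s x)
        rw [norm_sub_rev (linFlow G t x)] at this
        linarith
      have h4 : Λ⁻¹ + ‖u - linFlow G s x‖ ≤ M * b := by
        have : M * b = b / κ₁ + b + CT * b := by rw [hM]; ring
        rw [this]; linarith
      apply ENNReal.ofReal_le_ofReal
      gcongr
    have hint : ENNReal.ofReal (((M * b) ^ (d + 1))⁻¹) * ENNReal.ofReal h ≤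
        ∫⁻ s in Set.Icc (0 : ℝ) 2,
          ENNReal.ofReal (((Λ⁻¹ + ‖u - linFlow G s x‖) ^ (d + 1))⁻¹) := by
      calc _ = ∫⁻ _ in Set.Icc t (t + h), ENNReal.ofReal (((M * b) ^ (d + 1))⁻¹) := by
            rw [setLIntegral_const, Real.volume_Icc, add_sub_cancel_left]
        _ ≤ ∫⁻ s in Set.Icc t (t + h),
            ENNReal.ofReal (((Λ⁻¹ + ‖u - linFlow G s x‖) ^ (d + 1))⁻¹) :=
            setLIntegral_mono' measurableSet_Icc hlow
        _ ≤ _ := lintegral_mono_set hsub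
    refine le_trans ?_ (mul_le_mul_right hint _)
    rw [← ENNReal.ofReal_mul (by positivity), ← ENNReal.ofReal_mul (by positivity)]
    apply ENNReal.ofReal_le_ofReal
    have hΛh : K * σ ≤ K * (Λ * h) := by
      gcongr
      rw [hh, mul_min_of_nonneg _ _ hΛ0.le, mul_div_cancel₀ _ hΛ0.ne']
      exact le_min (by linarith) hσb
    have hfin : g ≤ K * M ^ (d + 1) * Λ * (((M * b) ^ (d + 1))⁻¹ * h) := by
      have e : K * M ^ (d + 1) * Λ * (((M * b) ^ (d + 1))⁻¹ * h) =
          K * (Λ * h) / b ^ (d + 1) := by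
        rw [mul_pow]; field_simp
      rw [e, le_div_iff₀ (by positivity)]
      exact hgK.trans hΛh
    refine hfin.trans ?_
    gcongr
    exact le_add_of_nonneg_left (by positivity)

end PointwiseBound

/-! ### Sets that meet orbits sparsely. -/

open scoped Pointwise in
/-- A set of reals meeting each coset of `δℤ` at most once has measure at most `δ`. -/
theorem volume_le_of_forall_add_notMem {S : Set ℝ} (hS : MeasurableSet S) {δ : ℝ} (hδ : 0 < δ)
    (h : ∀ s ∈ S, ∀ k : ℕ, 0 < k → s + k * δ ∉ S) : volume S ≤ ENNReal.ofReal δ := by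
  have hfd := isAddFundamentalDomain_Ioc hδ 0 volume
  have hdisj : Pairwise fun g₁ g₂ : AddSubgroup.zmultiples δ => Disjoint (g₁ +ᵥ S) (g₂ +ᵥ S) := by
    rintro ⟨_, k, rfl⟩ ⟨_, l, rfl⟩ hne
    rw [Set.disjoint_left]
    rintro _ ⟨s, hs, rfl⟩ ⟨s', hs', he⟩
    have he : (l • δ) + s' = (k • δ) + s := he
    simp only [zsmul_eq_mul] at he
    have hkl : k ≠ l := by rintro rfl; exact hne rfl
    rcases lt_or_gt_of_ne hkl with hlt | hlt
    · obtain ⟨m, hm⟩ := Int.eq_ofNat_of_zero_le (sub_nonneg.2 hlt.le)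
      have hm' : (l : ℝ) - k = m := by exact_mod_cast hm
      refine h s' hs' m (by omega) ?_
      rw [← hm']
      convert! hs using 1; linarith
    · obtain ⟨m, hm⟩ := Int.eq_ofNat_of_zero_le (sub_nonneg.2 hlt.le)
      have hm' : (k : ℝ) - l = m := by exact_mod_cast hm
      refine h s hs m (by omega) ?_
      rw [← hm']
      convert! hs' using 1; linarith
  have hle := hfd.measure_le_of_pairwise_disjoint hS.nullMeasurableSet
    (fun g₁ g₂ hne => ((hdisj hne).mono Set.inter_subset_left Set.inter_subset_left).aedisjoint)
  simpa using hle

/-- The kernel `(1/Λ + |z|)^{-(d+1)}` on a space of dimension `d`. -/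
noncomputable def flowKernel (V : Type*) [NormedAddCommGroup V] [NormedSpace ℝ V] (Λ : ℝ) (z : V) :
    ENNReal :=
  ENNReal.ofReal (((Λ⁻¹ + ‖z‖) ^ (Module.finrank ℝ V + 1))⁻¹)

theorem measurable_flowKernel {V : Type*} [NormedAddCommGroup V] [NormedSpace ℝ V]
    [MeasurableSpace V] [BorelSpace V] (Λ : ℝ) : Measurable (flowKernel V Λ) := by
  unfold flowKernel; fun_prop

section FlowSet

variable {V : Type*} [NormedAddCommGroup V] [NormedSpace ℝ V] [FiniteDimensional ℝ V]
  [MeasurableSpace V] [BorelSpace V] (μ : Measure V) [μ.IsAddHaarMeasure]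

open Module

theorem measurable_linFlow_apply (G : V →L[ℝ] V) :
    Measurable fun p : ℝ × V => linFlow G p.1 p.2 :=
  (continuous_linFlow_apply G).measurable

/-- Two visiting times differing by kδ would give two points of F, one a backward translate of the
other by kδ; hence the set of times meets each coset of δℤ at most once. -/
theorem lintegral_indicator_linFlow_le (G : V →L[ℝ] V) {F : Set V} (hF : MeasurableSet F) {δ : ℝ}
    (hδ : 0 < δ) (h : ∀ y ∈ F, ∀ k : ℕ, 0 < k → linFlow G (-(k * δ)) y ∉ F) (z : V) :
    ∫⁻ s : ℝ, F.indicator 1 (linFlow G (-s) z) ≤ ENNReal.ofReal δ := by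
  set S : Set ℝ := (fun s => linFlow G (-s) z) ⁻¹' F
  have hS : MeasurableSet S := by
    refine (Continuous.measurable ?_) hF
    exact (continuous_linFlow_apply G).comp (by fun_prop : Continuous fun s : ℝ => (-s, z))
  have : ∫⁻ s : ℝ, F.indicator 1 (linFlow G (-s) z) = volume S := by
    rw [← lintegral_indicator_one hS]; rfl
  rw [this]
  refine volume_le_of_forall_add_notMem hS hδ fun s hs k hk hmem => h _ hs k hk ?_
  rw [← linFlow_add]
  have e : -(k * δ) + -s = -(s + k * δ) := by ring
  rw [e]
  exact hmem

/-- Scaling by 1/Λ: the exponent exceeds the dimension by one, which gives convergence and leaves a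
single factor Λ. -/
theorem exists_lintegral_flowKernel_le :
    ∃ C : ℝ, 0 < C ∧ ∀ (Λ : ℝ), 0 < Λ → ∀ u : V,
      ∫⁻ z, flowKernel V Λ (u - z) ∂μ ≤ ENNReal.ofReal (C * Λ) := by
  set d := finrank ℝ V with hd
  have hfin := finite_integral_one_add_norm (μ := μ) (E := V) (r := d + 1) (by linarith)
  set I := ∫⁻ x : V, ENNReal.ofReal ((1 + ‖x‖) ^ (-((d : ℝ) + 1))) ∂μ with hI
  refine ⟨I.toReal + 1, by positivity, fun Λ hΛ u => ?_⟩
  rw [lintegral_sub_left_eq_self (fun z => flowKernel V Λ z) u]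
  have hmap := Measure.map_addHaar_smul μ (r := Λ⁻¹) (by positivity)
  have h1 : ∫⁻ z, flowKernel V Λ (Λ⁻¹ • z) ∂μ =
      ENNReal.ofReal (Λ ^ d) * ∫⁻ z, flowKernel V Λ z ∂μ := by
    rw [← lintegral_map (measurable_flowKernel Λ) (measurable_const_smul Λ⁻¹), hmap,
      lintegral_smul_measure, smul_eq_mul]
    congr 2
    rw [inv_pow, inv_inv, abs_of_pos (by positivity)]
  have h2 : ∫⁻ z, flowKernel V Λ (Λ⁻¹ • z) ∂μ = ENNReal.ofReal (Λ ^ (d + 1)) * I := by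
    rw [hI, ← lintegral_const_mul' _ _ ENNReal.ofReal_ne_top]
    congr 1 with z
    rw [flowKernel, ← ENNReal.ofReal_mul (by positivity), norm_smul, Real.norm_of_nonneg
      (by positivity), Real.rpow_neg (by positivity)]
    congr 1
    have : Λ⁻¹ + Λ⁻¹ * ‖z‖ = Λ⁻¹ * (1 + ‖z‖) := by ring
    rw [this, mul_pow, mul_inv, inv_pow, inv_inv, ← hd]
    congr 2
    exact_mod_cast (Real.rpow_natCast (1 + ‖z‖) (d + 1)).symm
  have h3 : ENNReal.ofReal (Λ ^ d) * ∫⁻ z, flowKernel V Λ z ∂μ =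
      ENNReal.ofReal (Λ ^ d) * (ENNReal.ofReal Λ * I) := by
    rw [← h1, h2, pow_succ, ENNReal.ofReal_mul (by positivity), mul_assoc]
  have h4 : ∫⁻ z, flowKernel V Λ z ∂μ = ENNReal.ofReal Λ * I :=
    (ENNReal.mul_right_inj (by simpa using by positivity) ENNReal.ofReal_ne_top).1 h3
  rw [h4, mul_comm, ENNReal.ofReal_mul (by positivity)]
  gcongr
  refine (ENNReal.ofReal_toReal hfin.ne).ge.trans (ENNReal.ofReal_le_ofReal ?_)
  exact le_add_of_nonneg_right (zero_le_one (α := ℝ))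

/-- After Fubini and the substitution z = T_s y, the time integral at fixed z is at most δ, and the
kernel contributes Λ. -/
theorem exists_lintegral_flow_average_le (G : V →L[ℝ] V) :
    ∃ C : ℝ, 0 < C ∧ ∀ (F : Set V) (δ Λ : ℝ), MeasurableSet F → 0 < δ → 0 < Λ →
      (∀ y ∈ F, ∀ k : ℕ, 0 < k → linFlow G (-(k * δ)) y ∉ F) → ∀ u : V,
      ∫⁻ y in F, (∫⁻ s in Set.Icc (0 : ℝ) 2, flowKernel V Λ (u - linFlow G s y)) ∂μ ≤
        ENNReal.ofReal (C * Λ * δ) := by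
  obtain ⟨C₁, hC₁, h₁⟩ := exists_lintegral_flowKernel_le (V := V) μ
  obtain ⟨C₂, hC₂, h₂⟩ := exists_lintegral_linFlow_le μ G 2
  refine ⟨C₂ * C₁, by positivity, fun F δ Λ hF hδ hΛ hlat u => ?_⟩
  have hind : Measurable (F.indicator (1 : V → ENNReal)) := measurable_one.indicator hF
  have hk : Measurable fun z : V => flowKernel V Λ (u - z) :=
    (measurable_flowKernel Λ).comp (measurable_const.sub measurable_id)
  have hm1 : Measurable fun p : V × ℝ => flowKernel V Λ (u - linFlow G p.2 p.1) :=
    hk.comp ((measurable_linFlow_apply G).comp measurable_swap)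
  have hm2 : Measurable fun p : ℝ × V =>
      F.indicator (1 : V → ENNReal) (linFlow G (-p.1) p.2) * flowKernel V Λ (u - p.2) :=
    (hind.comp ((measurable_linFlow_apply G).comp
      (measurable_fst.neg.prodMk measurable_snd))).mul (hk.comp measurable_snd)
  calc ∫⁻ y in F, (∫⁻ s in Set.Icc (0 : ℝ) 2, flowKernel V Λ (u - linFlow G s y)) ∂μ
      = ∫⁻ s in Set.Icc (0 : ℝ) 2, ∫⁻ y in F, flowKernel V Λ (u - linFlow G s y) ∂μ :=
        lintegral_lintegral_swap hm1.aemeasurable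
    _ ≤ ∫⁻ s in Set.Icc (0 : ℝ) 2, ENNReal.ofReal C₂ * ∫⁻ z,
          F.indicator (1 : V → ENNReal) (linFlow G (-s) z) * flowKernel V Λ (u - z) ∂μ := by
        refine setLIntegral_mono' measurableSet_Icc fun s hs => ?_
        refine le_trans (le_of_eq ?_) (h₂ s ⟨by linarith [hs.1], hs.2⟩
          (fun z => F.indicator (1 : V → ENNReal) (linFlow G (-s) z) * flowKernel V Λ (u - z))
          (hm2.comp (measurable_const.prodMk measurable_id)))
        rw [← lintegral_indicator hF]
        congr 1 with y
        rw [← linFlow_add, neg_add_cancel, linFlow_zero]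
        by_cases hy : y ∈ F <;> simp [hy]
    _ = ENNReal.ofReal C₂ * ∫⁻ z, (∫⁻ s in Set.Icc (0 : ℝ) 2,
          F.indicator (1 : V → ENNReal) (linFlow G (-s) z) * flowKernel V Λ (u - z)) ∂μ := by
        rw [lintegral_const_mul' _ _ ENNReal.ofReal_ne_top,
          lintegral_lintegral_swap hm2.aemeasurable]
    _ ≤ ENNReal.ofReal C₂ * ∫⁻ z, ENNReal.ofReal δ * flowKernel V Λ (u - z) ∂μ := by
        gcongr with z
        rw [lintegral_mul_const']
        · gcongr
          exact (setLIntegral_le_lintegral _ _).trans (lintegral_indicator_linFlow_le G hF hδ hlat z)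
        · exact ENNReal.ofReal_ne_top
    _ ≤ ENNReal.ofReal C₂ * (ENNReal.ofReal δ * ENNReal.ofReal (C₁ * Λ)) := by
        rw [lintegral_const_mul' _ _ ENNReal.ofReal_ne_top]
        gcongr
        exact h₁ Λ hΛ u
    _ = _ := by
        rw [← ENNReal.ofReal_mul hδ.le, ← ENNReal.ofReal_mul hC₂.le]
        congr 1; ring

/-- If `R` grows along the flow, the mass of a set `F` in an annulus is controlled by the mass of
the part of `F` reached first by the orbits. -/
theorem exists_lintegral_exp_neg_le (G : V →L[ℝ] V) {R : V → ℝ} (hR : Measurable R) {c : ℝ}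
    (hc : 0 < c)
    (hgrow : ∀ s, 0 ≤ s → s ≤ 1 → ∀ x, (1 + c * s) * R x ≤ R (linFlow G s x)) :
    ∃ C : ℝ, 0 < C ∧ ∀ (ρ : ℝ), 1 ≤ ρ → ∀ F : Set V, MeasurableSet F →
      (∀ x ∈ F, ρ ≤ R x ∧ R x ≤ 8 * ρ) → ∃ F₁ ⊆ F, MeasurableSet F₁ ∧
      (∀ y ∈ F₁, ∀ k : ℕ, 0 < k → linFlow G (-(k * ρ⁻¹)) y ∉ F₁) ∧
      ∫⁻ x in F, ENNReal.ofReal (Real.exp (-R x)) ∂μ ≤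
        ENNReal.ofReal C * ∫⁻ x in F₁, ENNReal.ofReal (Real.exp (-R x)) ∂μ := by
  -- Within the annulus R grows at most by the factor 8, while time kδ multiplies it by at least 1 +
  -- ckδ; so orbits joining two points of F take time at most 7/c.
  obtain ⟨C, hC, hCb⟩ := exists_lintegral_linFlow_le μ G (7 / c)
  have hsum : Summable fun k : ℕ => Real.exp (-c) ^ k :=
    summable_geometric_of_lt_one (Real.exp_pos _).le (Real.exp_lt_one_iff.2 (by linarith))
  refine ⟨C * ∑' k : ℕ, Real.exp (-c) ^ k, mul_pos hC (hsum.tsum_pos (fun k => by positivity) 0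
    (by simp)), fun ρ hρ F hF hFR => ?_⟩
  have hρ0 : 0 < ρ := by linarith
  set δ := ρ⁻¹ with hδ
  have hδ0 : 0 < δ := by positivity
  have hδ1 : δ ≤ 1 := inv_le_one_of_one_le₀ hρ
  have hδρ : δ * ρ = 1 := inv_mul_cancel₀ hρ0.ne'
  have hiter : ∀ (k : ℕ) (x : V), 0 ≤ R x → (1 + k * (c * δ)) * R x ≤ R (linFlow G (k * δ) x) := by
    intro k x hx
    have h1 : ∀ k : ℕ, (1 + c * δ) ^ k * R x ≤ R (linFlow G (k * δ) x) := by
      intro k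
      induction k with
      | zero => simp [linFlow_zero]
      | succ k ih =>
        have := hgrow δ hδ0.le hδ1 (linFlow G (k * δ) x)
        rw [← linFlow_add] at this
        have e : δ + k * δ = ((k + 1 : ℕ) : ℝ) * δ := by push_cast; ring
        rw [e] at this
        calc (1 + c * δ) ^ (k + 1) * R x = (1 + c * δ) * ((1 + c * δ) ^ k * R x) := by ring
          _ ≤ (1 + c * δ) * R (linFlow G (k * δ) x) := by gcongr
          _ ≤ _ := this
    refine le_trans ?_ (h1 k)
    gcongr
    exact one_add_mul_le_pow (by nlinarith [mul_pos hc hδ0]) k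
  have hback : ∀ (k : ℕ) (x : V), linFlow G (k * δ) (linFlow G (-(k * δ)) x) = x := by
    intro k x
    rw [← linFlow_add, add_neg_cancel, linFlow_zero]
  have hbound : ∀ (k : ℕ) (y : V), y ∈ F → linFlow G (k * δ) y ∈ F → (k : ℝ) * δ ≤ 7 / c := by
    intro k y hy hy'
    have h1 := hiter k y (by linarith [(hFR y hy).1])
    have h2 := (hFR _ hy').2
    have h3 : (1 + k * (c * δ)) * ρ ≤ 8 * ρ :=
      le_trans (by gcongr; exact (hFR y hy).1) (h1.trans h2)
    have h4 := le_of_mul_le_mul_right h3 hρ0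
    rw [le_div_iff₀ hc]; linarith
  set F₁ : Set V := F \ ⋃ k : ℕ, (linFlow G (-((k + 1 : ℕ) * δ))) ⁻¹' F with hF₁
  have hF₁m : MeasurableSet F₁ :=
    hF.diff (MeasurableSet.iUnion fun k => (linFlow G _).continuous.measurable hF)
  have hF₁n : ∀ y ∈ F₁, ∀ k : ℕ, 0 < k → linFlow G (-(k * δ)) y ∉ F := by
    intro y hy k hk hmem
    obtain ⟨m, rfl⟩ := Nat.exists_eq_succ_of_ne_zero hk.ne'
    exact hy.2 (Set.mem_iUnion.2 ⟨m, hmem⟩)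
  refine ⟨F₁, Set.sdiff_subset, hF₁m, fun y hy k hk h => hF₁n y hy k hk h.1, ?_⟩
  -- The largest k for which the backward translate by kδ is in F lands in F₁; it exists by the time
  -- bound just proved.
  have hcover : ∀ x ∈ F, ∃ k : ℕ, linFlow G (-(k * δ)) x ∈ F₁ := by
    intro x hx
    classical
    set P : ℕ → Prop := fun k => linFlow G (-(k * δ)) x ∈ F
    have hP0 : P 0 := by simpa [P, linFlow_zero] using hx
    have hPb : ∀ k, P k → k ≤ ⌊7 / c / δ⌋₊ := by
      intro k hk
      refine Nat.le_floor ?_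
      rw [le_div_iff₀ hδ0]
      exact hbound k _ hk (by rw [hback]; exact hx)
    refine ⟨Nat.findGreatest P ⌊7 / c / δ⌋₊, Nat.findGreatest_spec (Nat.zero_le _) hP0, ?_⟩
    rw [Set.mem_iUnion]
    rintro ⟨m, hm⟩
    rw [Set.mem_preimage, ← linFlow_add] at hm
    set K := Nat.findGreatest P ⌊7 / c / δ⌋₊
    have hPm : P (m + 1 + K) := by
      change linFlow G _ x ∈ F
      convert! hm using 2
      push_cast; ring_nf
    have := Nat.le_findGreatest (hPb _ hPm) hPm
    omega
  set w : V → ENNReal := fun x => ENNReal.ofReal (Real.exp (-R x)) with hw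
  have hwm : Measurable w := (hR.neg.exp).ennreal_ofReal
  set g : ℕ → V → ENNReal := fun k x =>
    F₁.indicator 1 (linFlow G (-(k * δ)) x) * F.indicator w x with hg
  have hgm : ∀ k, Measurable (g k) := fun k =>
    ((measurable_one.indicator hF₁m).comp (linFlow G _).continuous.measurable).mul
      (hwm.indicator hF)
  -- Since R ≥ ρ = 1/δ on F, k steps add at least ck to R, which produces the geometric factor
  -- e^{-ck}.
  have hstep : ∀ k : ℕ, ∫⁻ x, g k x ∂μ ≤
      ENNReal.ofReal (C * Real.exp (-c) ^ k) * ∫⁻ x in F₁, w x ∂μ := by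
    intro k
    have hpt : ∀ y, g k (linFlow G (k * δ) y) ≤
        ENNReal.ofReal (Real.exp (-c) ^ k) * F₁.indicator w y := by
      intro y
      have e : linFlow G (-(k * δ)) (linFlow G (k * δ) y) = y := by
        rw [← linFlow_add, neg_add_cancel, linFlow_zero]
      simp only [hg, e]
      by_cases hy : y ∈ F₁
      · by_cases hy' : linFlow G (k * δ) y ∈ F
        · simp only [Set.indicator_of_mem hy, Set.indicator_of_mem hy', Pi.one_apply, one_mul, hw]
          rw [← ENNReal.ofReal_mul (by positivity), ← Real.exp_nat_mul, ← Real.exp_add]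
          apply ENNReal.ofReal_le_ofReal
          apply Real.exp_le_exp.2
          have hyρ := (hFR y hy.1).1
          have h1 := hiter k y (by linarith)
          have h2 : (k : ℝ) * c ≤ k * (c * δ) * R y := by
            calc (k : ℝ) * c = k * (c * δ) * ρ := by
                  rw [mul_assoc, mul_assoc c, hδρ, mul_one]
              _ ≤ _ := by gcongr
          linarith
        · simp [hy']
      · simp [hy]
    by_cases hk : (k : ℝ) * δ ≤ 7 / c
    · have h7 : 0 < 7 / c := by positivity
      have h0 : 0 ≤ (k : ℝ) * δ := by positivity
      have hmeas : Measurable fun y => g k (linFlow G (k * δ) y) :=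
        (hgm k).comp (linFlow G _).continuous.measurable
      have h1 := hCb (-(k * δ)) ⟨by linarith, by linarith⟩ _ hmeas
      simp only [hback] at h1
      refine h1.trans ?_
      rw [ENNReal.ofReal_mul hC.le, mul_assoc]
      gcongr
      refine (lintegral_mono hpt).trans ?_
      rw [lintegral_const_mul' _ _ ENNReal.ofReal_ne_top, lintegral_indicator hF₁m]
    · have : ∀ x, g k x = 0 := by
        intro x
        simp only [hg]
        by_cases h1 : linFlow G (-(k * δ)) x ∈ F₁
        · by_cases h2 : x ∈ F
          · exact absurd (hbound k _ h1.1 (by rw [hback]; exact h2)) hk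
          · simp [h2]
        · simp [h1]
      simp [this]
  calc ∫⁻ x in F, w x ∂μ = ∫⁻ x, F.indicator w x ∂μ := (lintegral_indicator hF _).symm
    _ ≤ ∫⁻ x, ∑' k, g k x ∂μ := by
        refine lintegral_mono fun x => ?_
        by_cases hx : x ∈ F
        · obtain ⟨k, hk⟩ := hcover x hx
          refine le_trans ?_ (ENNReal.le_tsum k)
          simp [hg, hk]
        · simp [hx]
    _ = ∑' k, ∫⁻ x, g k x ∂μ := lintegral_tsum fun k => (hgm k).aemeasurable
    _ ≤ ∑' k : ℕ, ENNReal.ofReal (C * Real.exp (-c) ^ k) * ∫⁻ x in F₁, w x ∂μ :=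
        ENNReal.tsum_le_tsum hstep
    _ = _ := by
        rw [ENNReal.tsum_mul_right, ← tsum_mul_left,
          ENNReal.ofReal_tsum_of_nonneg (fun k => by positivity) (hsum.mul_left C)]

end FlowSet

theorem measurableSet_annulus {X : Type*} [MeasurableSpace X] {R : X → ℝ} (hR : Measurable R)
    {Ψ : X → ENNReal} (hΨ : Measurable Ψ) (ρ Λ A α : ℝ) :
    MeasurableSet {x | (ρ ≤ R x ∧ R x ≤ 8 * ρ) ∧ ENNReal.ofReal α <
      ENNReal.ofReal (A * Real.exp (R x) * Λ) * Ψ x} := by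
  have hm : Measurable fun x => ENNReal.ofReal (A * Real.exp (R x) * Λ) * Ψ x :=
    (((hR.exp.const_mul A).mul_const Λ).ennreal_ofReal).mul hΨ
  have h := measurableSet_lt (measurable_const (a := ENNReal.ofReal α)) hm
  exact ((measurableSet_le measurable_const hR).inter
    (measurableSet_le hR measurable_const)).inter h

theorem exists_one_add_norm_pow_le_exp {V : Type*} [NormedAddCommGroup V] {R : V → ℝ} {c : ℝ} (hc : 0 < c)
    (hlow : ∀ x, c * ‖x‖ ^ 2 ≤ R x) (d : ℕ) :
    ∃ K : ℝ, 0 < K ∧ ∀ x, (1 + ‖x‖) ^ d ≤ K * Real.exp (R x) := by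
  obtain ⟨K, hK, h⟩ := exists_one_add_pow_mul_exp_le d hc
  refine ⟨K, hK, fun x => ?_⟩
  have h1 := h ‖x‖ (norm_nonneg x)
  have h2 : (1 + ‖x‖) ^ d ≤ (1 + ‖x‖) ^ (d + 1) :=
    pow_le_pow_right₀ (by linarith [norm_nonneg x]) (Nat.le_succ d)
  have h3 : Real.exp (-c * ‖x‖ ^ 2) * Real.exp (c * ‖x‖ ^ 2) = 1 := by
    rw [← Real.exp_add]; simp
  calc (1 + ‖x‖) ^ d ≤ (1 + ‖x‖) ^ (d + 1) := h2
    _ = ((1 + ‖x‖) ^ (d + 1) * Real.exp (-c * ‖x‖ ^ 2)) * Real.exp (c * ‖x‖ ^ 2) := by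
        rw [mul_assoc, h3, mul_one]
    _ ≤ K * Real.exp (R x) := by
        gcongr
        exact hlow x

/-! ### The weak type estimate for a linear flow. -/

section WeakType

variable {V : Type*} [NormedAddCommGroup V] [NormedSpace ℝ V] [FiniteDimensional ℝ V]
  [MeasurableSpace V] [BorelSpace V] (μ : Measure V) [μ.IsAddHaarMeasure]

open Module

/-- Gaussian functions are integrable with respect to Haar measure. -/
theorem lintegral_exp_neg_mul_norm_sq_lt_top {c : ℝ} (hc : 0 < c) :
    ∫⁻ x : V, ENNReal.ofReal (Real.exp (-c * ‖x‖ ^ 2)) ∂μ < ⊤ := by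
  obtain ⟨K, hK, h⟩ := exists_one_add_pow_mul_exp_le (finrank ℝ V) hc
  have hfin := finite_integral_one_add_norm (μ := μ) (E := V) (r := finrank ℝ V + 1) (by linarith)
  refine lt_of_le_of_lt (lintegral_mono (g := fun x => ENNReal.ofReal K *
    ENNReal.ofReal ((1 + ‖x‖) ^ (-((finrank ℝ V : ℝ) + 1)))) fun x => ?_) ?_
  · simp only
    rw [← ENNReal.ofReal_mul hK.le]
    apply ENNReal.ofReal_le_ofReal
    have h1 := h ‖x‖ (norm_nonneg x)
    have h2 : (1 + ‖x‖) ^ (-((finrank ℝ V : ℝ) + 1)) = ((1 + ‖x‖) ^ (finrank ℝ V + 1))⁻¹ := by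
      rw [Real.rpow_neg (by positivity)]
      congr 1
      exact_mod_cast Real.rpow_natCast (1 + ‖x‖) (finrank ℝ V + 1)
    rw [h2, ← div_eq_mul_inv, le_div_iff₀ (by positivity)]
    linarith
  · rw [lintegral_const_mul' _ _ ENNReal.ofReal_ne_top]
    exact ENNReal.mul_lt_top ENNReal.ofReal_lt_top hfin

theorem measurable_lintegral_flowKernel (G : V →L[ℝ] V) (Λ : ℝ) (ν : Measure V) [SFinite ν] :
    Measurable fun x => ∫⁻ u, (∫⁻ s in Set.Icc (0 : ℝ) 2,
      flowKernel V Λ (u - linFlow G s x)) ∂ν := by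
  refine Measurable.lintegral_prod_right (f := fun x u => _) ?_
  refine Measurable.lintegral_prod_right (f := fun (p : V × V) (s : ℝ) =>
    flowKernel V Λ (p.2 - linFlow G s p.1)) ?_
  refine (measurable_flowKernel Λ).comp ?_
  exact (measurable_snd.comp measurable_fst).sub ((measurable_linFlow_apply G).comp
    (measurable_snd.prodMk (measurable_fst.comp measurable_fst)))

/-- Weak type estimate in an annulus. -/
theorem exists_lintegral_annulus_le (G : V →L[ℝ] V) {R : V → ℝ} (hR : Continuous R) {c : ℝ}
    (hc : 0 < c)
    (hgrow : ∀ s, 0 ≤ s → s ≤ 1 → ∀ x, (1 + c * s) * R x ≤ R (linFlow G s x)) :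
    ∃ C : ℝ, 0 < C ∧ ∀ (ρ Λ A α : ℝ) (ν : Measure V) [SFinite ν], 1 ≤ ρ → 0 < Λ → 0 < A → 0 < α →
      ∫⁻ x in {x | (ρ ≤ R x ∧ R x ≤ 8 * ρ) ∧ ENNReal.ofReal α <
          ENNReal.ofReal (A * Real.exp (R x) * Λ) * ∫⁻ u, (∫⁻ s in Set.Icc (0 : ℝ) 2,
            flowKernel V Λ (u - linFlow G s x)) ∂ν},
        ENNReal.ofReal (Real.exp (-R x)) ∂μ ≤
      ENNReal.ofReal (C * A * Λ ^ 2 / ρ / α) * ν Set.univ := by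
  obtain ⟨C₁, hC₁, h₁⟩ := exists_lintegral_exp_neg_le μ G hR.measurable hc hgrow
  obtain ⟨C₂, hC₂, h₂⟩ := exists_lintegral_flow_average_le μ G
  refine ⟨C₁ * C₂, by positivity, fun ρ Λ A α ν _ hρ hΛ hA hα => ?_⟩
  have hρ0 : 0 < ρ := by linarith
  set Ψ : V → ENNReal := fun x => ∫⁻ u, (∫⁻ s in Set.Icc (0 : ℝ) 2,
    flowKernel V Λ (u - linFlow G s x)) ∂ν with hΨ
  have hΨm : Measurable Ψ := measurable_lintegral_flowKernel G Λ ν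
  set F : Set V := {x | (ρ ≤ R x ∧ R x ≤ 8 * ρ) ∧ ENNReal.ofReal α <
    ENNReal.ofReal (A * Real.exp (R x) * Λ) * Ψ x} with hF
  have hFm : MeasurableSet F := measurableSet_annulus hR.measurable hΨm ρ Λ A α
  obtain ⟨F₁, hF₁F, hF₁m, hF₁, hle⟩ := h₁ ρ hρ F hFm fun x hx => hx.1
  refine hle.trans ?_
  -- Chebyshev on F₁: the factor e^{R} of the majorant cancels the density e^{-R}, leaving Haar
  -- measure, to which the orbit estimate applies.
  have hstep : ENNReal.ofReal α * ∫⁻ x in F₁, ENNReal.ofReal (Real.exp (-R x)) ∂μ ≤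
      ENNReal.ofReal (A * Λ) * (ENNReal.ofReal (C₂ * Λ * ρ⁻¹) * ν Set.univ) := by
    calc ENNReal.ofReal α * ∫⁻ x in F₁, ENNReal.ofReal (Real.exp (-R x)) ∂μ
        = ∫⁻ x in F₁, ENNReal.ofReal α * ENNReal.ofReal (Real.exp (-R x)) ∂μ :=
          (lintegral_const_mul' _ _ ENNReal.ofReal_ne_top).symm
      _ ≤ ∫⁻ x in F₁, ENNReal.ofReal (A * Λ) * Ψ x ∂μ := by
          refine setLIntegral_mono' hF₁m fun x hx => ?_
          have h3 := (hF₁F hx).2.le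
          calc _ ≤ (ENNReal.ofReal (A * Real.exp (R x) * Λ) * Ψ x) *
                ENNReal.ofReal (Real.exp (-R x)) := by gcongr
            _ = (ENNReal.ofReal (A * Real.exp (R x) * Λ) * ENNReal.ofReal (Real.exp (-R x))) *
                Ψ x := by ring
            _ = _ := by
                rw [← ENNReal.ofReal_mul (by positivity)]
                congr 2
                have : Real.exp (R x) * Real.exp (-R x) = 1 := by rw [← Real.exp_add]; simp
                linear_combination A * Λ * this
      _ = ENNReal.ofReal (A * Λ) * ∫⁻ u, (∫⁻ x in F₁, (∫⁻ s in Set.Icc (0 : ℝ) 2,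
            flowKernel V Λ (u - linFlow G s x)) ∂μ) ∂ν := by
          rw [lintegral_const_mul' _ _ ENNReal.ofReal_ne_top]
          congr 1
          refine lintegral_lintegral_swap (Measurable.aemeasurable ?_)
          refine Measurable.lintegral_prod_right (f := fun (p : V × V) (s : ℝ) =>
            flowKernel V Λ (p.2 - linFlow G s p.1)) ?_
          refine (measurable_flowKernel Λ).comp ?_
          exact (measurable_snd.comp measurable_fst).sub ((measurable_linFlow_apply G).comp
            (measurable_snd.prodMk (measurable_fst.comp measurable_fst)))
      _ ≤ ENNReal.ofReal (A * Λ) * ∫⁻ _, ENNReal.ofReal (C₂ * Λ * ρ⁻¹) ∂ν := by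
          gcongr with u
          exact h₂ F₁ ρ⁻¹ Λ hF₁m (by positivity) hΛ hF₁ u
      _ = _ := by rw [lintegral_const]
  have hα' : ENNReal.ofReal α ≠ 0 := by simpa using hα
  rw [mul_comm, ← ENNReal.le_div_iff_mul_le (Or.inl hα') (Or.inl ENNReal.ofReal_ne_top)] at hstep
  calc _ ≤ ENNReal.ofReal C₁ * ((ENNReal.ofReal (A * Λ) *
        (ENNReal.ofReal (C₂ * Λ * ρ⁻¹) * ν Set.univ)) / ENNReal.ofReal α) := by gcongr
    _ = (ENNReal.ofReal C₁ * ENNReal.ofReal (A * Λ) * ENNReal.ofReal (C₂ * Λ * ρ⁻¹) *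
        ENNReal.ofReal α⁻¹) * ν Set.univ := by
        rw [ENNReal.ofReal_inv_of_pos hα, div_eq_mul_inv]; ring
    _ = _ := by
        rw [← ENNReal.ofReal_mul hC₁.le, ← ENNReal.ofReal_mul (by positivity),
          ← ENNReal.ofReal_mul (by positivity)]
        congr 2
        field_simp

/-- An abstract weak type `(1,1)` estimate for operators dominated by averages along the orbits of
a linear flow that expands `R`. -/
theorem exists_weakType_flow (G : V →L[ℝ] V) {R : V → ℝ} (hR : Continuous R) {a c : ℝ}
    (ha : 0 < a) (hlow : ∀ x, a * ‖x‖ ^ 2 ≤ R x) (hc : 0 < c)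
    (hgrow : ∀ s, 0 ≤ s → s ≤ 1 → ∀ x, (1 + c * s) * R x ≤ R (linFlow G s x)) {A : ℝ}
    (hA : 0 < A) :
    ∃ C : ℝ, 0 < C ∧ ∀ (ν : Measure V) [IsFiniteMeasure ν] (T : V → ENNReal),
      (∀ x, T x ≤ ENNReal.ofReal (A * Real.exp (R x) * (1 + ‖x‖) ^ finrank ℝ V) * ν Set.univ) →
      (∀ x Λ, 1 + ‖x‖ ≤ Λ → T x ≤ ENNReal.ofReal (A * Real.exp (R x) * Λ) *
        ∫⁻ u, (∫⁻ s in Set.Icc (0 : ℝ) 2, flowKernel V Λ (u - linFlow G s x)) ∂ν) →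
      ∀ α : ℝ, 0 < α →
        μ.withDensity (fun x => ENNReal.ofReal (Real.exp (-R x))) {x | ENNReal.ofReal α < T x} ≤
          ENNReal.ofReal (C / α) * ν Set.univ := by
  obtain ⟨C₁, hC₁, h₁⟩ := exists_lintegral_annulus_le μ G hR hc hgrow
  obtain ⟨K, hK, hKb⟩ := exists_one_add_norm_pow_le_exp ha hlow (finrank ℝ V)
  have hR0 : ∀ x, 0 ≤ R x := fun x => le_trans (by positivity) (hlow x)
  set M : ENNReal := ∫⁻ x, ENNReal.ofReal (Real.exp (-(R x / 2))) ∂μ with hM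
  have hMtop : M < ⊤ := by
    refine lt_of_le_of_lt (lintegral_mono fun x => ENNReal.ofReal_le_ofReal ?_)
      (lintegral_exp_neg_mul_norm_sq_lt_top μ (half_pos ha))
    apply Real.exp_le_exp.2
    linarith [hlow x]
  set γ := μ.withDensity (fun x => ENNReal.ofReal (Real.exp (-R x))) with hγ
  have hγuniv : γ Set.univ ≤ M := by
    rw [hγ, withDensity_apply _ MeasurableSet.univ, setLIntegral_univ]
    refine lintegral_mono fun x => ENNReal.ofReal_le_ofReal (Real.exp_le_exp.2 ?_)
    linarith [hR0 x]
  -- Half of the exponent gives e^{-4ρ}; the other half remains integrable, with integral `M`.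
  have htail : ∀ ρ, γ {x | 8 * ρ < R x} ≤ ENNReal.ofReal (Real.exp (-(4 * ρ))) * M := by
    intro ρ
    rw [hγ, withDensity_apply _ (measurableSet_lt measurable_const hR.measurable), hM,
      ← lintegral_const_mul' _ _ ENNReal.ofReal_ne_top]
    refine le_trans (setLIntegral_mono' (measurableSet_lt measurable_const hR.measurable)
      fun x hx => ?_) (setLIntegral_le_lintegral _ _)
    rw [← ENNReal.ofReal_mul (by positivity), ← Real.exp_add]
    apply ENNReal.ofReal_le_ofReal (Real.exp_le_exp.2 _)
    have hx : 8 * ρ < R x := hx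
    linarith
  set b : ℝ := 1 + √(8 / a) with hb
  -- For α/N = e^{4ρ} above this threshold, e^4 ensures ρ ≥ 1, and the square ensures AK < e^{2ρ},
  -- as needed to place the level set in {R ≥ ρ}.
  set N₀ : ℝ := max ((A * K + 1) ^ 2) (Real.exp 4) with hN₀
  have hN₀0 : 0 < N₀ := lt_of_lt_of_le (Real.exp_pos 4) (le_max_right _ _)
  have hM0 : 0 ≤ M.toReal := ENNReal.toReal_nonneg
  refine ⟨N₀ * M.toReal + (C₁ * A * b ^ 2 + M.toReal), by positivity,
    fun ν _ T hT₁ hT₂ α hα => ?_⟩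
  set N : ℝ := (ν Set.univ).toReal with hN
  have hνN : ν Set.univ = ENNReal.ofReal N := (ENNReal.ofReal_toReal (measure_ne_top ν _)).symm
  rcases (ENNReal.toReal_nonneg (a := ν Set.univ)).eq_or_lt with hN0 | hN0
  · have hν0 : ν Set.univ = 0 := by rw [hνN, hN, ← hN0]; simp
    have : {x | ENNReal.ofReal α < T x} = ∅ := by
      ext x
      have := hT₁ x
      rw [hν0, mul_zero] at this
      simp [nonpos_iff_eq_zero.1 this]
    rw [this]; simp
  have hN0 : 0 < N := hN0
  have hMr : M = ENNReal.ofReal M.toReal := (ENNReal.ofReal_toReal hMtop.ne).symm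
  rw [hνN, ← ENNReal.ofReal_mul (by positivity)]
  rcases le_or_gt (α / N) N₀ with hsmall | hlarge
  · refine (measure_mono (Set.subset_univ _)).trans (hγuniv.trans ?_)
    rw [hMr]
    apply ENNReal.ofReal_le_ofReal
    rw [div_le_iff₀ hN0] at hsmall
    rw [div_mul_eq_mul_div, le_div_iff₀ hα, ENNReal.toReal_ofReal hM0]
    have : 0 ≤ (C₁ * A * b ^ 2 + M.toReal) * N := by positivity
    calc M.toReal * α ≤ M.toReal * (N₀ * N) := by gcongr
      _ ≤ _ := by linarith
  have hαN : 0 < α / N := by positivity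
  set ρ := Real.log (α / N) / 4 with hρ
  have hexp : Real.exp (4 * ρ) = α / N := by
    rw [hρ, mul_div_cancel₀ _ (by norm_num : (4 : ℝ) ≠ 0), Real.exp_log hαN]
  have hρ1 : 1 ≤ ρ := by
    have h4 : Real.exp 4 ≤ Real.exp (4 * ρ) := by
      rw [hexp]; exact (le_max_right _ _).trans hlarge.le
    have := Real.exp_le_exp.1 h4
    linarith
  have hρ0 : 0 < ρ := by linarith
  set Λ := b * √ρ with hΛ
  have hb0 : 0 < b := by positivity
  have hΛ0 : 0 < Λ := by positivity
  -- The polynomial factor is absorbed by one more e^{R}, so e^{4ρ} < AK e^{2R}; with AK < e^{2ρ}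
  -- this forces R > ρ.
  have hlower : ∀ x, ENNReal.ofReal α < T x → ρ ≤ R x := by
    intro x hx
    have h2 := hx.trans_le (hT₁ x)
    rw [hνN, ← ENNReal.ofReal_mul (by positivity)] at h2
    have h3 := (ENNReal.ofReal_lt_ofReal_iff_of_nonneg hα.le).1 h2
    have h4 : α / N < A * K * Real.exp (R x) ^ 2 := by
      rw [div_lt_iff₀ hN0]
      calc α < _ := h3
        _ ≤ A * Real.exp (R x) * (K * Real.exp (R x)) * N := by gcongr; exact hKb x
        _ = _ := by ring
    have h5 : (A * K + 1) ^ 2 < Real.exp (4 * ρ) := by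
      rw [hexp]; exact (le_max_left _ _).trans_lt hlarge
    have h6 : Real.exp (4 * ρ) = Real.exp (2 * ρ) ^ 2 := by
      rw [← Real.exp_nat_mul]; congr 1; push_cast; ring
    rw [h6] at h5
    have h7 : A * K + 1 < Real.exp (2 * ρ) := lt_of_pow_lt_pow_left₀ 2 (by positivity) h5
    rw [← hexp, h6] at h4
    have h8 : Real.exp (2 * ρ) ^ 2 < Real.exp (2 * ρ) * Real.exp (R x) ^ 2 :=
      h4.trans (by gcongr; linarith)
    rw [sq, mul_lt_mul_iff_right₀ (Real.exp_pos _), ← Real.exp_nat_mul] at h8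
    have h9 := Real.exp_lt_exp.1 h8
    push_cast at h9
    linarith
  have hnorm : ∀ x, R x ≤ 8 * ρ → 1 + ‖x‖ ≤ Λ := by
    intro x hx
    have h2 : ‖x‖ ≤ √(8 / a) * √ρ := by
      rw [← Real.sqrt_mul (by positivity)]
      apply Real.le_sqrt_of_sq_le
      rw [div_mul_eq_mul_div, le_div_iff₀ ha]
      linarith [hlow x]
    have h3 : 1 ≤ √ρ := Real.one_le_sqrt.2 hρ1
    rw [hΛ, hb, add_mul, one_mul]
    linarith
  set F : Set V := {x | (ρ ≤ R x ∧ R x ≤ 8 * ρ) ∧ ENNReal.ofReal α <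
    ENNReal.ofReal (A * Real.exp (R x) * Λ) * ∫⁻ u, (∫⁻ s in Set.Icc (0 : ℝ) 2,
      flowKernel V Λ (u - linFlow G s x)) ∂ν} with hF
  have hFm : MeasurableSet F :=
    measurableSet_annulus hR.measurable (measurable_lintegral_flowKernel G Λ ν) ρ Λ A α
  have hsub : {x | ENNReal.ofReal α < T x} ⊆ F ∪ {x | 8 * ρ < R x} := by
    intro x hx
    rcases le_or_gt (R x) (8 * ρ) with h | h
    · exact Or.inl ⟨⟨hlower x hx, h⟩, lt_of_lt_of_le hx (hT₂ x Λ (hnorm x h))⟩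
    · exact Or.inr h
  refine (measure_mono hsub).trans ((measure_union_le _ _).trans ?_)
  have hF1 : γ F ≤ ENNReal.ofReal (C₁ * A * b ^ 2 / α * N) := by
    rw [hγ, withDensity_apply _ hFm]
    refine (h₁ ρ Λ A α ν hρ1 hΛ0 hA hα).trans ?_
    rw [hνN, ← ENNReal.ofReal_mul (by positivity)]
    apply ENNReal.ofReal_le_ofReal
    apply le_of_eq
    rw [hΛ, mul_pow, Real.sq_sqrt hρ0.le]
    field_simp
  have hF2 : γ {x | 8 * ρ < R x} ≤ ENNReal.ofReal (M.toReal / α * N) := by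
    refine (htail ρ).trans ?_
    rw [hMr, ← ENNReal.ofReal_mul (by positivity), ENNReal.toReal_ofReal hM0]
    apply ENNReal.ofReal_le_ofReal
    apply le_of_eq
    rw [Real.exp_neg, hexp]
    field_simp
  refine (add_le_add hF1 hF2).trans ?_
  rw [← ENNReal.ofReal_add (by positivity) (by positivity)]
  apply ENNReal.ofReal_le_ofReal
  have : 0 ≤ N₀ * M.toReal / α * N := by positivity
  calc _ ≤ N₀ * M.toReal / α * N + (C₁ * A * b ^ 2 / α * N + M.toReal / α * N) := by linarith
    _ = _ := by ring

end WeakType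

/-! ### Application to the Mehler kernel. -/

variable {n : ℕ}

/-- The normalizing constant of the density of `γ_∞`. -/
noncomputable def gammaConst (Q B : Matrix (Fin n) (Fin n) ℝ) : ℝ :=
  (2 * Real.pi) ^ (-(n : ℝ) / 2) * (Qinf Q B).det ^ (-(1 : ℝ) / 2)

theorem gammaInf_eq_smul {Q B : Matrix (Fin n) (Fin n) ℝ} (h : 0 ≤ gammaConst Q B) :
    gammaInf Q B = ENNReal.ofReal (gammaConst Q B) •
      volume.withDensity fun x => ENNReal.ofReal (Real.exp (-R Q B x)) := by
  have hm : Measurable fun x => ENNReal.ofReal (Real.exp (-R Q B x)) :=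
    (continuous_R Q B).measurable.neg.exp.ennreal_ofReal
  rw [← withDensity_smul _ hm, gammaInf]
  congr 1 with x
  rw [Pi.smul_apply, smul_eq_mul, ← ENNReal.ofReal_mul h, gammaConst]

/-- Bounds for the global part of the maximal kernel. -/
theorem exists_iSup_mehler_le {Q B : Matrix (Fin n) (Fin n) ℝ} (hQ : Q.PosDef)
    (hB : EigenvaluesNegRe B) :
    ∃ A : ℝ, 0 < A ∧ ∀ (L : Localization n) (x u : E n) (Λ : ℝ), 1 + ‖x‖ ≤ Λ →
      (⨆ t ∈ Set.Ioc (0 : ℝ) 1, ENNReal.ofReal (mehler Q B t x u * (1 - L.eta x u))) ≤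
        ENNReal.ofReal (A * Real.exp (R Q B x) * Λ ^ Module.finrank ℝ (E n)) ∧
      (⨆ t ∈ Set.Ioc (0 : ℝ) 1, ENNReal.ofReal (mehler Q B t x u * (1 - L.eta x u))) ≤
        ENNReal.ofReal (A * Real.exp (R Q B x) * Λ) * ∫⁻ s in Set.Icc (0 : ℝ) 2,
          flowKernel (E n) Λ (u - linFlow (flowGen Q B) s x) := by
  have hP := posDef_Qinf hQ hB
  obtain ⟨C, c, hC, hc, hm⟩ := exists_mehler_le hQ hB
  obtain ⟨C', hC', hg⟩ := exists_gaussian_flow_le (flowGen Q B) (Module.finrank ℝ (E n)) hc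
    (by norm_num : (0 : ℝ) < 1 / 10)
  refine ⟨C * C', by positivity, fun L x u Λ hΛ => ?_⟩
  have hΛ0 : 0 < Λ := by linarith [norm_nonneg x]
  rcases lt_or_ge ‖x - u‖ (1 / 10 / (1 + ‖x‖)) with h | h
  · have h0 : (⨆ t ∈ Set.Ioc (0 : ℝ) 1,
        ENNReal.ofReal (mehler Q B t x u * (1 - L.eta x u))) = 0 := by
      simp [L.eta_eq_one h]
    rw [h0]
    exact ⟨zero_le, zero_le⟩
  have hle : ∀ t ∈ Set.Ioc (0 : ℝ) 1, mehler Q B t x u * (1 - L.eta x u) ≤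
      C * Real.exp (R Q B x) * ((√t ^ Module.finrank ℝ (E n))⁻¹ *
        Real.exp (-c * (‖u - linFlow (flowGen Q B) t x‖ / √t) ^ 2)) := by
    intro t ht
    have h1 := hm t ht.1 ht.2 x u
    rw [toEuclideanCLM_D hP.isUnit] at h1
    have h2 : 0 ≤ mehler Q B t x u :=
      mehler_nonneg Q B (div_nonneg hP.det_pos.le (posDef_Qt hQ B ht.1 ht.2).det_pos.le) x u
    rw [finrank_euclideanSpace_fin]
    refine le_trans ?_ h1
    exact mul_le_of_le_one_right h2 (by linarith [L.eta_nonneg x u])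
  constructor
  · refine iSup₂_le fun t ht => ENNReal.ofReal_le_ofReal ((hle t ht).trans ?_)
    calc _ ≤ C * Real.exp (R Q B x) * (C' * Λ ^ Module.finrank ℝ (E n)) := by
          exact mul_le_mul_of_nonneg_left (hg t ht.1 ht.2 x u Λ hΛ h).1 (by positivity)
      _ = _ := by ring
  · refine iSup₂_le fun t ht => (ENNReal.ofReal_le_ofReal (hle t ht)).trans ?_
    rw [ENNReal.ofReal_mul (by positivity)]
    have e : C * C' * Real.exp (R Q B x) * Λ = C * Real.exp (R Q B x) * (C' * Λ) := by ring
    rw [e, ENNReal.ofReal_mul (p := C * Real.exp (R Q B x)) (by positivity), mul_assoc]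
    gcongr
    exact (hg t ht.1 ht.2 x u Λ hΛ h).2

theorem exists_weakType_S0glob {Q B : Matrix (Fin n) (Fin n) ℝ} (hQ : Q.PosDef)
    (hB : EigenvaluesNegRe B) :
    ∃ C : ℝ, 0 < C ∧ ∀ (L : Localization n) (f : E n → ℂ), Measurable f →
      Integrable f (gammaInf Q B) → ∀ α : ℝ, 0 < α →
        gammaInf Q B {x | ENNReal.ofReal α < S0glob Q B L f x} ≤
          ENNReal.ofReal (C / α * ∫ u, ‖f u‖ ∂(gammaInf Q B)) := by
  have hP := posDef_Qinf hQ hB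
  have hk : 0 < gammaConst Q B := by
    have := hP.det_pos
    unfold gammaConst
    positivity
  obtain ⟨a, _, ha, _, hlow⟩ := exists_R_bounds hP
  obtain ⟨c, hc, hgrow⟩ := exists_le_R_D hQ hB
  obtain ⟨A, hA, hker⟩ := exists_iSup_mehler_le hQ hB
  obtain ⟨C, hC, hweak⟩ := exists_weakType_flow volume (flowGen Q B) (continuous_R Q B) ha
    (fun x => (hlow x).1) hc (fun s hs hs1 x => by
      have := hgrow s hs hs1 x
      rwa [toEuclideanCLM_D hP.isUnit] at this) hA
  -- The normalizing constant appears only once: the measure ν = |f| dγ_∞ on the right already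
  -- contains it.
  refine ⟨gammaConst Q B * C, by positivity, fun L f hf hfi α hα => ?_⟩
  set ν : Measure (E n) := (gammaInf Q B).withDensity fun u => ‖f u‖ₑ
  have hνuniv : ν Set.univ = ENNReal.ofReal (∫ u, ‖f u‖ ∂(gammaInf Q B)) := by
    rw [withDensity_apply _ MeasurableSet.univ, setLIntegral_univ,
      ofReal_integral_norm_eq_lintegral_enorm hfi]
  have : IsFiniteMeasure ν := ⟨by rw [hνuniv]; exact ENNReal.ofReal_lt_top⟩
  have hW := hweak ν (S0glob Q B L f) (fun x => ?_) (fun x Λ hΛ => ?_) α hα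
  · have hN : 0 ≤ ∫ u, ‖f u‖ ∂(gammaInf Q B) := integral_nonneg fun _ => norm_nonneg _
    rw [hνuniv, ← ENNReal.ofReal_mul (by positivity)] at hW
    generalize ∫ u, ‖f u‖ ∂(gammaInf Q B) = N at hW hN
    rw [gammaInf_eq_smul hk.le, Measure.smul_apply, smul_eq_mul]
    refine (mul_le_mul_right hW _).trans ?_
    rw [← ENNReal.ofReal_mul hk.le]
    apply ENNReal.ofReal_le_ofReal
    apply le_of_eq
    ring
  · have hν : ν Set.univ = ∫⁻ u, ‖f u‖ₑ ∂(gammaInf Q B) := by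
      rw [withDensity_apply _ MeasurableSet.univ, setLIntegral_univ]
    rw [hν, ← lintegral_const_mul' _ _ ENNReal.ofReal_ne_top, S0glob]
    gcongr with u
    exact (hker L x u _ le_rfl).1
  · have hJ : Measurable fun u => ∫⁻ s in Set.Icc (0 : ℝ) 2,
        flowKernel (E n) Λ (u - linFlow (flowGen Q B) s x) := by
      refine Measurable.lintegral_prod_right (f := fun (u : E n) (s : ℝ) =>
        flowKernel (E n) Λ (u - linFlow (flowGen Q B) s x)) ?_
      refine (measurable_flowKernel Λ).comp (measurable_fst.sub ?_)
      exact (measurable_linFlow_apply _).comp (measurable_snd.prodMk measurable_const)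
    rw [lintegral_withDensity_eq_lintegral_mul _ hf.enorm hJ,
      ← lintegral_const_mul' _ _ ENNReal.ofReal_ne_top, S0glob]
    refine lintegral_mono fun u => ?_
    rw [Pi.mul_apply, mul_left_comm, mul_comm]
    gcongr
    exact (hker L x u Λ hΛ).2

end OrnsteinUhlenbeck

theorem theorem10p1 (n : ℕ) (hn : 1 ≤ n) (Q B : Matrix (Fin n) (Fin n) ℝ)
    (hQ : Q.PosDef) (hB : OrnsteinUhlenbeck.EigenvaluesNegRe B) :
    ∃ C : ℝ, 0 < C ∧
      ∀ (L : OrnsteinUhlenbeck.Localization n) (f : OrnsteinUhlenbeck.E n → ℂ),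
        Integrable f (OrnsteinUhlenbeck.gammaInf Q B) →
          AEMeasurable (OrnsteinUhlenbeck.S0glob Q B L f) (OrnsteinUhlenbeck.gammaInf Q B) ∧
          ∀ α : ℝ, 0 < α →
            OrnsteinUhlenbeck.gammaInf Q B
                {x | ENNReal.ofReal α < OrnsteinUhlenbeck.S0glob Q B L f x} ≤
              ENNReal.ofReal (C / α * ∫ u, ‖f u‖ ∂(OrnsteinUhlenbeck.gammaInf Q B)) := by
  obtain ⟨C, hC, hweak⟩ := OrnsteinUhlenbeck.exists_weakType_S0glob hQ hB
  refine ⟨C, hC, fun L f hf => ?_⟩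
  -- The operator depends only on the almost-everywhere class of f, so f may be replaced by a
  -- measurable representative.
  obtain ⟨g, hg, hfg⟩ := hf.aestronglyMeasurable
  rw [OrnsteinUhlenbeck.S0glob_congr_ae Q B L hfg]
  refine ⟨(OrnsteinUhlenbeck.measurable_S0glob Q B
    (OrnsteinUhlenbeck.posDef_Qinf hQ hB).det_pos.le
    (fun t ht => (OrnsteinUhlenbeck.posDef_Qt hQ B ht.1 ht.2).det_pos.le) L
    hg.measurable).aemeasurable, fun α hα => ?_⟩
  have hint : ∫ u, ‖f u‖ ∂(OrnsteinUhlenbeck.gammaInf Q B) =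
      ∫ u, ‖g u‖ ∂(OrnsteinUhlenbeck.gammaInf Q B) := by
    refine integral_congr_ae ?_
    filter_upwards [hfg] with u hu
    rw [hu]
  rw [hint]
  exact hweak L g hg.measurable (hf.congr hfg) α hα
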